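/- Let $p\colon E\to N$ be a fibred manifold (a surjective smooth submersion), $\dim N=n$, $\dim E=m+n$, and let $v_n$ be a smooth nowhere vanishing $n$-form on $N$. Let $J^1E$ be the manifold of $1$-jets $j^1_xs$ of local sections of $p$, with projections $p^1_0\colon J^1E\to E$ and $p^1\colon J^1E\to N$. In fibred coordinates $(x^i,y^\alpha)$, with induced coordinates $(x^i,y^\alpha,y^\alpha_i)$ on $J^1E$, let $\theta=(dy^\alpha-y^\alpha_i\,dx^i)\otimes\partial/\partial y^\alpha$ be the contact form with values in the vertical bundle $V(p)$, and for $L\in C^\infty(J^1E)$ and $\Lambda=Lv_n$ let $$\omega_\Lambda=\frac{\partial L}{\partial y^\alpha_i}\, i_{\partial/\partial x^i}v_n\otimes dy^\alpha$$ be the Legendre form, a $V^*(p)$-valued $(n-1)$-form on $J^1E$. The Poincaré–Cartan form of $\Lambda$ is $\Theta_\Lambda=\theta\wedge\omega_\Lambda+\Lambda$, where the exterior product is taken with respect to the duality pairing between $V(p)$ and $V^*(p)$. Let $\gamma$ be an Ehresmann connection on $E$, that is, a smooth $V(p)$-valued $1$-form on $E$ with $\gamma(X)=X$ for every $X\in V(p)$;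 locally $\gamma=(dy^\alpha+\gamma^\alpha_i\,dx^i)\otimes\partial/\partial y^\alpha$. The covariant Hamiltonian $\Lambda^\gamma=((p^1_0)^*\gamma-\theta)\wedge\omega_\Lambda-\Lambda$ is a Lagrangian density: there is a unique function $L^\gamma$ on $J^1E$ with $\Lambda^\gamma=L^\gamma v_n$. Finally, $(p^1_0)^*\gamma-\theta=(\gamma^\alpha_i+y^\alpha_i)\,dx^i\otimes\partial/\partial y^\alpha$ is viewed as a section of $(p^1_0)^*(p^*T^*N\otimes V(p))$, which is naturally isomorphic to the bundle $V(p^1_0)$ of $p^1_0$-vertical tangent vectors of $J^1E$, and $\langle(p^1_0)^*\gamma-\theta,\,dL|_{V(p^1_0)}\rangle$ denotes its pairing with the restriction of $dL$ to $V(p^1_0)$. Proposition. For every $L\in C^\infty(J^1E)$, the equation $L^\gamma=0$ holds if and only if (i) the Poincaré–Cartan form of $\Lambda=Lv_n$ projects onto $E$, i.e. $\Theta_\Lambda=(p^1_0)^*\eta$ for some smooth $n$-form $\eta$ on $E$; and (ii) $L=\langle(p^1_0)^*\gamma-\theta,\,dL|_{V(p^1_0)}\rangle$. -/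

import Mathlib

open scoped Manifold ContDiff Topology
open Set

/-- The model space of `k`-dimensional manifolds. -/
abbrev Eu (k : ℕ) : Type := EuclideanSpace ℝ (Fin k)

/-- The model space `(ℝⁿ × ℝᵐ) × Hom(ℝⁿ, ℝᵐ)` of the first jet manifold, with the coordinates
`((xⁱ, y^α), y^α_i)`. -/
abbrev JetModel (n m : ℕ) : Type := (Eu n × Eu m) × (Eu n →L[ℝ] Eu m)

/-- A fibred manifold: a surjective smooth submersion from a manifold of dimension `m + n`
onto a manifold of dimension `n`. -/
structure FibredManifold (n m : ℕ) (E N : Type*)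
    [TopologicalSpace E] [ChartedSpace (Eu (m + n)) E]
    [TopologicalSpace N] [ChartedSpace (Eu n) N] where
  proj : E → N
  surjective : Function.Surjective proj
  submersion : Manifold.IsSubmersionOfComplement (Eu m)
    𝓘(ℝ, Eu (m + n)) 𝓘(ℝ, Eu n) ∞ proj

noncomputable section

/-! ### Forms -/

section Forms

variable {V W : Type*} [AddCommGroup V] [Module ℝ V] [AddCommGroup W] [Module ℝ W]

/-- The interior product `i_X α`; it vanishes on `0`-forms. -/
def interiorProduct : {k : ℕ} → V → V [⋀^Fin k]→ₗ[ℝ] ℝ → V [⋀^Fin (k - 1)]→ₗ[ℝ] ℝ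
  | 0, _, _ => 0
  | _ + 1, X, α => α.curryLeft X

/-- The exterior product `β ∧ α` of a `W`-valued `1`-form `β` with a `W*`-valued `(k-1)`-form `α`
(a linear map from `W` to `(k-1)`-forms), with respect to the duality pairing:
`(β ∧ α)(Z₀, …, Z_{k-1}) = ∑ p, (-1)^p ⟨β(Z_p), α(Z₀, …, Ẑ_p, …, Z_{k-1})⟩`.
There are no forms of degree `-1`, so the product is `0` when `k = 0`. -/
def wedgeDual : {k : ℕ} → (V →ₗ[ℝ] W) → (W →ₗ[ℝ] V [⋀^Fin (k - 1)]→ₗ[ℝ] ℝ) →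
    V [⋀^Fin k]→ₗ[ℝ] ℝ
  | 0, _, _ => 0
  | _ + 1, β, α => AlternatingMap.alternatizeUncurryFin (α ∘ₗ β)

end Forms

/-- A differential form is smooth if its components in the charts of the manifold are smooth. -/
def IsSmoothForm {d k : ℕ} {M : Type*} [TopologicalSpace M] [ChartedSpace (Eu d) M]
    (α : ∀ x : M, TangentSpace 𝓘(ℝ, Eu d) x [⋀^Fin k]→ₗ[ℝ] ℝ) : Prop :=
  ∀ (x₀ : M) (w : Fin k → Eu d), ContDiffOn ℝ ∞
    (fun a : Eu d => α ((chartAt (Eu d) x₀).symm a)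
      (fun i => mfderiv 𝓘(ℝ, Eu d) 𝓘(ℝ, Eu d) (chartAt (Eu d) x₀).symm a (w i)))
    (chartAt (Eu d) x₀).target

/-- A smooth nowhere vanishing `n`-form on an `n`-dimensional manifold. -/
structure VolumeForm (n : ℕ) (N : Type*) [TopologicalSpace N] [ChartedSpace (Eu n) N] where
  toFun : ∀ x : N, TangentSpace 𝓘(ℝ, Eu n) x [⋀^Fin n]→ₗ[ℝ] ℝ
  smooth : IsSmoothForm toFun
  ne_zero : ∀ x, toFun x ≠ 0

namespace FibredManifold

variable {n m : ℕ} {E N : Type*}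
  [TopologicalSpace E] [ChartedSpace (Eu (m + n)) E]
  [TopologicalSpace N] [ChartedSpace (Eu n) N]

/-- The tangent space `T_e E`. -/
abbrev TE (_P : FibredManifold n m E N) (e : E) : Type := TangentSpace 𝓘(ℝ, Eu (m + n)) e
/-- The tangent space `T_{p(e)} N`. -/
abbrev TN (P : FibredManifold n m E N) (e : E) : Type := TangentSpace 𝓘(ℝ, Eu n) (P.proj e)

/-- The differential of `p : E → N` at `e`. -/
def dproj (P : FibredManifold n m E N) (e : E) : P.TE e →L[ℝ] P.TN e :=
  mfderiv 𝓘(ℝ, Eu (m + n)) 𝓘(ℝ, Eu n) P.proj e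

/-- The vertical space `V_e(p) = ker (p_*)_e`. -/
abbrev Vert (P : FibredManifold n m E N) (e : E) : Submodule ℝ (P.TE e) :=
  LinearMap.ker (P.dproj e).toLinearMap

/-- The first jet manifold `J¹E`. The jet `j¹_x s` of a local section `s` is given by the point
`s(x)` and the differential of `s` at `x`; the linear maps which arise in this way are those
`T_{p(e)} N → T_e E` that are right inverse to the differential of `p` at `e`. -/
structure Jet (P : FibredManifold n m E N) where
  pt : E
  lift : P.TN pt →L[ℝ] P.TE pt
  dproj_lift : ∀ v, P.dproj pt (lift v) = v

/-- A fibred coordinate system: smooth coordinates `total = (xⁱ, y^α)` on an open subset of `E` and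
`base = (xⁱ)` on an open subset of `N`, compatible with the projection. -/
structure FibredChart (P : FibredManifold n m E N) where
  total : OpenPartialHomeomorph E (Eu n × Eu m)
  base : OpenPartialHomeomorph N (Eu n)
  smooth_total : ContMDiffOn 𝓘(ℝ, Eu (m + n)) 𝓘(ℝ, Eu n × Eu m) ∞ total total.source
  smooth_total_symm : ContMDiffOn 𝓘(ℝ, Eu n × Eu m) 𝓘(ℝ, Eu (m + n)) ∞ total.symm total.target
  smooth_base : ContMDiffOn 𝓘(ℝ, Eu n) 𝓘(ℝ, Eu n) ∞ base base.source
  smooth_base_symm : ContMDiffOn 𝓘(ℝ, Eu n) 𝓘(ℝ, Eu n) ∞ base.symm base.target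
  proj_mem : ∀ e ∈ total.source, P.proj e ∈ base.source
  fst_total : ∀ e ∈ total.source, (total e).1 = base (P.proj e)

theorem exists_fibredChart [IsManifold 𝓘(ℝ, Eu (m + n)) ∞ E] [IsManifold 𝓘(ℝ, Eu n) ∞ N]
    (P : FibredManifold n m E N) (e : E) : ∃ c : P.FibredChart, e ∈ c.total.source := by
  have h := P.submersion e
  refine ⟨⟨h.domChart.trans h.equiv.toHomeomorph.toOpenPartialHomeomorph, h.codChart,
    ?_, ?_, ?_, ?_, ?_, ?_⟩, ?_⟩
  · have h1 := contMDiffOn_of_mem_maximalAtlas h.domChart_mem_maximalAtlas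
    have h2 : ContMDiff 𝓘(ℝ, Eu (m + n)) 𝓘(ℝ, Eu n × Eu m) ∞ h.equiv :=
      h.equiv.contDiff.contMDiff
    simpa using h2.comp_contMDiffOn h1
  · have h1 := contMDiffOn_symm_of_mem_maximalAtlas h.domChart_mem_maximalAtlas
    have h2 : ContMDiff 𝓘(ℝ, Eu n × Eu m) 𝓘(ℝ, Eu (m + n)) ∞ h.equiv.symm :=
      h.equiv.symm.contDiff.contMDiff
    exact h1.comp h2.contMDiffOn (fun x hx => by simpa using hx)
  · exact contMDiffOn_of_mem_maximalAtlas h.codChart_mem_maximalAtlas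
  · exact contMDiffOn_symm_of_mem_maximalAtlas h.codChart_mem_maximalAtlas
  · intro e he
    exact h.source_subset_preimage_source (by simpa using he)
  · intro e he
    have he' : e ∈ h.domChart.source := by simpa using he
    have hm : h.domChart e ∈ (h.domChart.extend 𝓘(ℝ, Eu (m + n))).target := by
      simp [he']
    have := h.writtenInCharts hm
    simp only [Function.comp_apply, OpenPartialHomeomorph.extend_coe_symm,
      OpenPartialHomeomorph.extend_coe, modelWithCornersSelf_coe, id,
      modelWithCornersSelf_coe_symm, h.domChart.left_inv he'] at this
    exact this.symm
  · simpa using h.mem_domChart_source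

namespace FibredChart

variable {P : FibredManifold n m E N} (c c' : P.FibredChart)

/-- The differential of the coordinates `(xⁱ, y^α)`. -/
def dtotal (e : E) : Eu (m + n) →L[ℝ] Eu n × Eu m :=
  mfderiv 𝓘(ℝ, Eu (m + n)) 𝓘(ℝ, Eu n × Eu m) c.total e

def dtotalSymm (a : Eu n × Eu m) : Eu n × Eu m →L[ℝ] Eu (m + n) :=
  mfderiv 𝓘(ℝ, Eu n × Eu m) 𝓘(ℝ, Eu (m + n)) c.total.symm a

def dbase (x : N) : Eu n →L[ℝ] Eu n := mfderiv 𝓘(ℝ, Eu n) 𝓘(ℝ, Eu n) c.base x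

def dbaseSymm (b : Eu n) : Eu n →L[ℝ] Eu n := mfderiv 𝓘(ℝ, Eu n) 𝓘(ℝ, Eu n) c.base.symm b

theorem mdiff_total : c.total.MDifferentiable 𝓘(ℝ, Eu (m + n)) 𝓘(ℝ, Eu n × Eu m) :=
  ⟨c.smooth_total.mdifferentiableOn (by simp), c.smooth_total_symm.mdifferentiableOn (by simp)⟩

theorem mdiff_base : c.base.MDifferentiable 𝓘(ℝ, Eu n) 𝓘(ℝ, Eu n) :=
  ⟨c.smooth_base.mdifferentiableOn (by simp), c.smooth_base_symm.mdifferentiableOn (by simp)⟩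

theorem dtotalSymm_dtotal {e : E} (he : e ∈ c.total.source) (v : Eu (m + n)) :
    c.dtotalSymm (c.total e) (c.dtotal e v) = v :=
  DFunLike.congr_fun (c.mdiff_total.symm_comp_deriv he) v

theorem dtotal_dtotalSymm {a : Eu n × Eu m} (ha : a ∈ c.total.target) (w : Eu n × Eu m) :
    c.dtotal (c.total.symm a) (c.dtotalSymm a w) = w :=
  DFunLike.congr_fun (c.mdiff_total.comp_symm_deriv ha) w

theorem dbaseSymm_dbase {x : N} (hx : x ∈ c.base.source) (v : Eu n) :
    c.dbaseSymm (c.base x) (c.dbase x v) = v :=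
  DFunLike.congr_fun (c.mdiff_base.symm_comp_deriv hx) v

theorem dbase_dbaseSymm {x : N} (hx : x ∈ c.base.source) (v : Eu n) :
    c.dbase x (c.dbaseSymm (c.base x) v) = v := by
  have := DFunLike.congr_fun (c.mdiff_base.comp_symm_deriv (c.base.map_source hx)) v
  rw [c.base.left_inv hx] at this
  exact this

end FibredChart

theorem mdifferentiable_proj (P : FibredManifold n m E N) :
    MDifferentiable 𝓘(ℝ, Eu (m + n)) 𝓘(ℝ, Eu n) P.proj :=
  P.submersion.contMDiff.mdifferentiable (by simp)

namespace FibredChart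

variable {P : FibredManifold n m E N} (c c' : P.FibredChart)

theorem fst_dtotal {e : E} (he : e ∈ c.total.source) (v : Eu (m + n)) :
    (c.dtotal e v).1 = c.dbase (P.proj e) (P.dproj e v) := by
  have h1 : HasMFDerivAt 𝓘(ℝ, Eu (m + n)) 𝓘(ℝ, Eu n × Eu m) c.total e (c.dtotal e) :=
    (c.mdiff_total.mdifferentiableAt he).hasMFDerivAt
  have h2 : HasMFDerivAt 𝓘(ℝ, Eu n × Eu m) 𝓘(ℝ, Eu n) (Prod.fst : Eu n × Eu m → Eu n)
      (c.total e) (ContinuousLinearMap.fst ℝ (Eu n) (Eu m)) :=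
    hasFDerivAt_fst.hasMFDerivAt
  have h3 : HasMFDerivAt 𝓘(ℝ, Eu (m + n)) 𝓘(ℝ, Eu n) P.proj e (P.dproj e) :=
    (P.mdifferentiable_proj e).hasMFDerivAt
  have h4 : HasMFDerivAt 𝓘(ℝ, Eu n) 𝓘(ℝ, Eu n) c.base (P.proj e) (c.dbase (P.proj e)) :=
    (c.mdiff_base.mdifferentiableAt (c.proj_mem e he)).hasMFDerivAt
  have h5 := h2.comp e h1
  have h6 := (h4.comp e h3).congr_of_eventuallyEq (f₁ := Prod.fst ∘ c.total)
    (Filter.eventuallyEq_of_mem (c.total.open_source.mem_nhds he) c.fst_total)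
  exact DFunLike.congr_fun (hasMFDerivAt_unique h5 h6) v

end FibredChart

namespace Jet

variable {P : FibredManifold n m E N}

theorem ext' {j k : P.Jet} (h : j.pt = k.pt)
    (hl : (j.lift : Eu n →L[ℝ] Eu (m + n)) = (k.lift : Eu n →L[ℝ] Eu (m + n))) : j = k := by
  obtain ⟨e, l, _⟩ := j
  obtain ⟨e', l', _⟩ := k
  cases (show e = e' from h)
  cases (show l = l' from hl)
  rfl

end Jet

namespace FibredChart

variable {P : FibredManifold n m E N} (c c' : P.FibredChart)

/-- The coordinates `(xⁱ, y^α, y^α_i)` of a jet induced by a fibred coordinate system; the last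
entry is the matrix of the partial derivatives `∂(y^α ∘ s)/∂xⁱ`. -/
def jetCoord (j : P.Jet) : JetModel n m :=
  (c.total j.pt, (ContinuousLinearMap.snd ℝ (Eu n) (Eu m)).comp
    ((c.dtotal j.pt).comp
      ((j.lift : Eu n →L[ℝ] Eu (m + n)).comp (c.dbaseSymm (c.base (P.proj j.pt))))))

/-- The differential of the local section with given coordinates of its jet. -/
def coordLift (q : JetModel n m) : Eu n →L[ℝ] Eu (m + n) :=
  (c.dtotalSymm q.1).comp
    (((ContinuousLinearMap.id ℝ (Eu n)).prod q.2).comp (c.dbase (P.proj (c.total.symm q.1))))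

theorem dproj_coordLift (q : JetModel n m) (hq : q.1 ∈ c.total.target) (v : Eu n) :
    P.dproj (c.total.symm q.1) (c.coordLift q v) = v := by
  have he := c.total.map_target hq
  have hx := c.proj_mem _ he
  have h1 := c.fst_dtotal he (c.coordLift q v)
  have h2 : (c.dtotal (c.total.symm q.1) (c.coordLift q v)).1
      = c.dbase (P.proj (c.total.symm q.1)) v := by
    simp only [coordLift, ContinuousLinearMap.comp_apply]
    rw [c.dtotal_dtotalSymm hq]
    rfl
  rw [h2] at h1
  have h3 := congrArg (c.dbaseSymm (c.base (P.proj (c.total.symm q.1)))) h1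
  rw [c.dbaseSymm_dbase hx] at h3
  exact ((h3.trans (c.dbaseSymm_dbase hx _)).symm)

/-- The jet with given coordinates. -/
def ofJetCoord (q : JetModel n m) (hq : q.1 ∈ c.total.target) : P.Jet where
  pt := c.total.symm q.1
  lift := c.coordLift q
  dproj_lift := c.dproj_coordLift q hq

theorem ofJetCoord_jetCoord (j : P.Jet) (hj : j.pt ∈ c.total.source) :
    c.ofJetCoord (c.jetCoord j) (c.total.map_source hj) = j := by
  have hpt : c.total.symm (c.jetCoord j).1 = j.pt := c.total.left_inv hj
  refine Jet.ext' hpt ?_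
  suffices h : ∀ v : Eu n,
      c.coordLift (c.jetCoord j) v = (j.lift : Eu n →L[ℝ] Eu (m + n)) v from
    ContinuousLinearMap.ext h
  intro v
  have hx := c.proj_mem _ hj
  have h1 : c.dbase (P.proj j.pt) v = (c.dtotal j.pt ((j.lift : Eu n →L[ℝ] Eu (m + n)) v)).1 := by
    refine Eq.trans ?_ (c.fst_dtotal hj (j.lift v)).symm
    exact congrArg (c.dbase (P.proj j.pt)) (j.dproj_lift v).symm
  have h2 : c.coordLift (c.jetCoord j) v = c.dtotalSymm (c.total j.pt)
      (c.dtotal j.pt ((j.lift : Eu n →L[ℝ] Eu (m + n)) v)) := by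
    change c.dtotalSymm (c.total j.pt) (((ContinuousLinearMap.id ℝ (Eu n)).prod
      (c.jetCoord j).2) (c.dbase (P.proj (c.total.symm (c.jetCoord j).1)) v)) = _
    rw [hpt]
    congr 1
    refine Prod.ext h1 ?_
    change (c.dtotal j.pt ((j.lift : Eu n →L[ℝ] Eu (m + n))
      (c.dbaseSymm (c.base (P.proj j.pt)) (c.dbase (P.proj j.pt) v)))).2 = _
    rw [c.dbaseSymm_dbase hx]
  exact h2.trans (c.dtotalSymm_dtotal hj _)

theorem jetCoord_ofJetCoord (q : JetModel n m) (hq : q.1 ∈ c.total.target) :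
    c.jetCoord (c.ofJetCoord q hq) = q := by
  have he := c.total.map_target hq
  have hx := c.proj_mem _ he
  refine Prod.ext (c.total.right_inv hq) ?_
  ext1 v
  change (c.dtotal (c.total.symm q.1) (c.dtotalSymm q.1
    (((ContinuousLinearMap.id ℝ (Eu n)).prod q.2) (c.dbase (P.proj (c.total.symm q.1))
      (c.dbaseSymm (c.base (P.proj (c.total.symm q.1))) v))))).2 = q.2 v
  rw [c.dtotal_dtotalSymm hq, c.dbase_dbaseSymm hx]
  rfl

/-- The change of coordinates on `E`. -/
def transTotal : Eu n × Eu m → Eu n × Eu m := c'.total ∘ c.total.symm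

/-- The change of coordinates on `N`. -/
def transBase : Eu n → Eu n := c'.base ∘ c.base.symm

theorem contDiffOn_transTotal :
    ContDiffOn ℝ ∞ (c.transTotal c') (c.total.symm.trans c'.total).source := by
  rw [← contMDiffOn_iff_contDiffOn]
  refine c'.smooth_total.comp (c.smooth_total_symm.mono ?_) ?_
  · exact fun x hx => hx.1
  · exact fun x hx => hx.2

theorem contDiffOn_transBase :
    ContDiffOn ℝ ∞ (c.transBase c') (c.base.symm.trans c'.base).source := by
  rw [← contMDiffOn_iff_contDiffOn]
  refine c'.smooth_base.comp (c.smooth_base_symm.mono ?_) ?_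
  · exact fun x hx => hx.1
  · exact fun x hx => hx.2

theorem fderiv_transTotal {a : Eu n × Eu m} (ha : a ∈ (c.total.symm.trans c'.total).source) :
    fderiv ℝ (c.transTotal c') a = (c'.dtotal (c.total.symm a)).comp (c.dtotalSymm a) := by
  have h1 : HasMFDerivAt 𝓘(ℝ, Eu n × Eu m) 𝓘(ℝ, Eu (m + n)) c.total.symm a (c.dtotalSymm a) :=
    (c.mdiff_total.symm.mdifferentiableAt ha.1).hasMFDerivAt
  have h2 : HasMFDerivAt 𝓘(ℝ, Eu (m + n)) 𝓘(ℝ, Eu n × Eu m) c'.total (c.total.symm a)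
      (c'.dtotal (c.total.symm a)) := (c'.mdiff_total.mdifferentiableAt ha.2).hasMFDerivAt
  have h3 : HasFDerivAt (c.transTotal c') ((c'.dtotal (c.total.symm a)).comp (c.dtotalSymm a)) a :=
    hasMFDerivAt_iff_hasFDerivAt.1 (h2.comp a h1)
  exact h3.fderiv

theorem fderiv_transBase {b : Eu n} (hb : b ∈ (c.base.symm.trans c'.base).source) :
    fderiv ℝ (c.transBase c') b = (c'.dbase (c.base.symm b)).comp (c.dbaseSymm b) := by
  have h1 : HasMFDerivAt 𝓘(ℝ, Eu n) 𝓘(ℝ, Eu n) c.base.symm b (c.dbaseSymm b) :=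
    (c.mdiff_base.symm.mdifferentiableAt hb.1).hasMFDerivAt
  have h2 : HasMFDerivAt 𝓘(ℝ, Eu n) 𝓘(ℝ, Eu n) c'.base (c.base.symm b)
      (c'.dbase (c.base.symm b)) := (c'.mdiff_base.mdifferentiableAt hb.2).hasMFDerivAt
  have h3 : HasFDerivAt (c.transBase c') ((c'.dbase (c.base.symm b)).comp (c.dbaseSymm b)) b :=
    hasMFDerivAt_iff_hasFDerivAt.1 (h2.comp b h1)
  exact h3.fderiv

theorem fst_transTotal_mem {a : Eu n × Eu m} (ha : a ∈ (c.total.symm.trans c'.total).source) :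
    (c.transTotal c' a).1 = c'.base (P.proj (c.total.symm a)) ∧
    (c.transTotal c' a).1 ∈ (c'.base.symm.trans c.base).source := by
  have h1 : (c.transTotal c' a).1 = c'.base (P.proj (c.total.symm a)) := c'.fst_total _ ha.2
  have hx' : P.proj (c.total.symm a) ∈ c'.base.source := c'.proj_mem _ ha.2
  refine ⟨h1, ?_⟩
  rw [h1]
  refine ⟨c'.base.map_source hx', ?_⟩
  change c'.base.symm (c'.base (P.proj (c.total.symm a))) ∈ c.base.source
  rw [c'.base.left_inv hx']
  have ha1 : a ∈ c.total.target := ha.1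
  exact c.proj_mem (c.total.symm a) (c.total.map_target ha1)

end FibredChart

variable [IsManifold 𝓘(ℝ, Eu (m + n)) ∞ E] [IsManifold 𝓘(ℝ, Eu n) ∞ N]

theorem exists_jet (P : FibredManifold n m E N) (e : E) : ∃ j : P.Jet, j.pt = e := by
  obtain ⟨c, hc⟩ := P.exists_fibredChart e
  exact ⟨c.ofJetCoord (c.total e, 0) (c.total.map_source hc), c.total.left_inv hc⟩

namespace FibredChart

variable {P : FibredManifold n m E N} (c c' : P.FibredChart)

open Classical in
/-- The chart of `J¹E` induced by a fibred coordinate system. -/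
def jetChart : PartialEquiv P.Jet (JetModel n m) where
  toFun := c.jetCoord
  invFun q := if hq : q.1 ∈ c.total.target then c.ofJetCoord q hq
    else (P.exists_jet (c.total.symm q.1)).choose
  source := {j | j.pt ∈ c.total.source}
  target := {q | q.1 ∈ c.total.target}
  map_source' _ hj := c.total.map_source hj
  map_target' q hq := by
    have hq' : q.1 ∈ c.total.target := hq
    simp only [hq', dif_pos, mem_ofPred_eq]
    exact c.total.map_target hq
  left_inv' j hj := by
    have : (c.jetCoord j).1 ∈ c.total.target := c.total.map_source hj
    simp only [this, dif_pos]
    exact c.ofJetCoord_jetCoord j hj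
  right_inv' q hq := by
    have hq' : q.1 ∈ c.total.target := hq
    simp only [hq', dif_pos]
    exact c.jetCoord_ofJetCoord q hq

theorem jetChart_symm_of_mem {q : JetModel n m} (hq : q.1 ∈ c.total.target) :
    c.jetChart.symm q = c.ofJetCoord q hq := dif_pos hq

theorem jetChart_symm_trans_source : (c.jetChart.symm.trans c'.jetChart).source =
    Prod.fst ⁻¹' (c.total.symm.trans c'.total).source := by
  ext q
  simp only [PartialEquiv.trans_source, PartialEquiv.symm_source, mem_inter_iff, mem_preimage,
    OpenPartialHomeomorph.trans_source, OpenPartialHomeomorph.symm_source]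
  refine and_congr_right fun hq => ?_
  rw [c.jetChart_symm_of_mem hq]
  rfl

theorem jetChart_trans_apply {q : JetModel n m}
    (hq : q.1 ∈ (c.total.symm.trans c'.total).source) :
    (c.jetChart.symm.trans c'.jetChart) q = (c.transTotal c' q.1,
      (ContinuousLinearMap.snd ℝ (Eu n) (Eu m)).comp ((fderiv ℝ (c.transTotal c') q.1).comp
        (((ContinuousLinearMap.id ℝ (Eu n)).prod q.2).comp
          (fderiv ℝ (c'.transBase c) (c.transTotal c' q.1).1)))) := by
  obtain ⟨h1, h2⟩ := c.fst_transTotal_mem c' hq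
  have h : (c.jetChart.symm.trans c'.jetChart) q = c'.jetCoord (c.ofJetCoord q hq.1) := by
    change c'.jetCoord (c.jetChart.symm q) = _
    rw [c.jetChart_symm_of_mem hq.1]
  have hx' : P.proj (c.total.symm q.1) ∈ c'.base.source := c'.proj_mem _ hq.2
  rw [c.fderiv_transTotal c' hq, c'.fderiv_transBase c h2, h1, c'.base.left_inv hx']
  exact h

theorem contDiffOn_jetChart_trans : ContDiffOn ℝ ∞ (c.jetChart.symm.trans c'.jetChart)
    (c.jetChart.symm.trans c'.jetChart).source := by
  rw [c.jetChart_symm_trans_source c']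
  refine ContDiffOn.congr ?_ (fun q hq => c.jetChart_trans_apply c' hq)
  have hT := c.contDiffOn_transTotal c'
  have hB := c'.contDiffOn_transBase c
  have hfst : ContDiffOn ℝ ∞ (Prod.fst : JetModel n m → Eu n × Eu m)
      (Prod.fst ⁻¹' (c.total.symm.trans c'.total).source) := contDiff_fst.contDiffOn
  have hT1 := hT.comp hfst (fun q hq => hq)
  have hdT := (hT.fderiv_of_isOpen (c.total.symm.trans c'.total).open_source
    (m := ∞) (by simp)).comp hfst (fun q hq => hq)
  have hdB := (hB.fderiv_of_isOpen (c'.base.symm.trans c.base).open_source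
    (m := ∞) (by simp)).comp hT1.fst (fun q hq => (c.fst_transTotal_mem c' hq).2)
  have hA : ContDiffOn ℝ ∞ (fun q : JetModel n m => (ContinuousLinearMap.id ℝ (Eu n)).prod q.2)
      (Prod.fst ⁻¹' (c.total.symm.trans c'.total).source) := by
    refine ContDiff.contDiffOn ?_
    have h2 : (fun q : JetModel n m => (ContinuousLinearMap.id ℝ (Eu n)).prod q.2) =
      fun q => (ContinuousLinearMap.inl ℝ (Eu n) (Eu m)) +
        (ContinuousLinearMap.inr ℝ (Eu n) (Eu m)).comp q.2 := by
      ext q v <;> simp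
    rw [h2]
    exact contDiff_const.add (contDiff_const.clm_comp contDiff_snd)
  exact hT1.prodMk (contDiffOn_const.clm_comp (hdT.clm_comp (hA.clm_comp hdB)))

end FibredChart

/-- The manifold structure of `J¹E`: the charts are those induced by all fibred coordinate systems. -/
def jetCore (P : FibredManifold n m E N) : ChartedSpaceCore (JetModel n m) P.Jet where
  atlas := range (FibredChart.jetChart (P := P))
  chartAt j := (P.exists_fibredChart j.pt).choose.jetChart
  mem_chart_source j := (P.exists_fibredChart j.pt).choose_spec
  chart_mem_atlas j := mem_range_self _
  open_source := by
    rintro _ _ ⟨c, rfl⟩ ⟨c', rfl⟩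
    rw [c.jetChart_symm_trans_source c']
    exact (c.total.symm.trans c'.total).open_source.preimage continuous_fst
  continuousOn_toFun := by
    rintro _ _ ⟨c, rfl⟩ ⟨c', rfl⟩
    exact (c.contDiffOn_jetChart_trans c').continuousOn

instance (P : FibredManifold n m E N) : TopologicalSpace P.Jet := P.jetCore.toTopologicalSpace

instance (P : FibredManifold n m E N) : ChartedSpace (JetModel n m) P.Jet :=
  P.jetCore.toChartedSpace

instance (P : FibredManifold n m E N) : IsManifold 𝓘(ℝ, JetModel n m) ∞ P.Jet := by
  refine isManifold_of_contDiffOn _ _ _ ?_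
  intro e e' he he'
  obtain ⟨_, ⟨⟨c, rfl⟩, rfl⟩⟩ := mem_iUnion₂.1 he
  obtain ⟨_, ⟨⟨c', rfl⟩, rfl⟩⟩ := mem_iUnion₂.1 he'
  have h := c.contDiffOn_jetChart_trans c'
  simp only [modelWithCornersSelf_coe, modelWithCornersSelf_coe_symm, Function.comp_id,
    Function.id_comp, preimage_id, range_id, inter_univ]
  exact h

/-! ## Tangent maps, contact form -/

/-- The tangent space `T_j(J¹E)`. -/
abbrev TJ (P : FibredManifold n m E N) (j : P.Jet) : Type :=
  TangentSpace 𝓘(ℝ, JetModel n m) j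

/-- The projection `p¹₀ : J¹E → E`. -/
def toTotal (P : FibredManifold n m E N) (j : P.Jet) : E := j.pt

/-- The projection `p¹ : J¹E → N`. -/
def toBase (P : FibredManifold n m E N) (j : P.Jet) : N := P.proj j.pt

/-- The differential of `p¹₀`. -/
def dtoTotal (P : FibredManifold n m E N) (j : P.Jet) : P.TJ j →L[ℝ] P.TE j.pt :=
  mfderiv 𝓘(ℝ, JetModel n m) 𝓘(ℝ, Eu (m + n)) P.toTotal j

/-- The differential of `p¹`. -/
def dtoBase (P : FibredManifold n m E N) (j : P.Jet) : P.TJ j →L[ℝ] P.TN j.pt :=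
  mfderiv 𝓘(ℝ, JetModel n m) 𝓘(ℝ, Eu n) P.toBase j

/-- The `V(p)`-valued contact form `θ = (dy^α - y^α_i dxⁱ) ⊗ ∂/∂y^α` on `J¹E`: at the jet `j¹_x s` it
is `θ(Z) = (p¹₀)_* Z - s_* p_* (p¹₀)_* Z`. -/
def contactForm (P : FibredManifold n m E N) (j : P.Jet) : P.TJ j →L[ℝ] P.Vert j.pt :=
  (P.dtoTotal j - j.lift.comp ((P.dproj j.pt).comp (P.dtoTotal j))).codRestrict (P.Vert j.pt)
    (fun Z => by simp [j.dproj_lift])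

/-- An Ehresmann connection: a smooth `1`-form `γ` on `E` with values in `V(p)` such that
`γ(X) = X` for every vertical `X`. -/
structure EhresmannConnection (P : FibredManifold n m E N) where
  toFun : ∀ e : E, P.TE e →L[ℝ] P.TE e
  smooth : ContMDiff 𝓘(ℝ, Eu (m + n))
    (𝓘(ℝ, Eu (m + n)).prod 𝓘(ℝ, Eu (m + n) →L[ℝ] Eu (m + n))) ∞
    (fun e : E => Bundle.TotalSpace.mk' (Eu (m + n) →L[ℝ] Eu (m + n))
      (E := fun e : E => TangentSpace 𝓘(ℝ, Eu (m + n)) e →L[ℝ] TangentSpace 𝓘(ℝ, Eu (m + n)) e)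
      e (toFun e))
  mem_vert : ∀ e X, toFun e X ∈ P.Vert e
  apply_vert : ∀ e, ∀ X ∈ P.Vert e, toFun e X = X

/-- The form `γ` as a map into the vertical spaces. -/
def EhresmannConnection.toVert {P : FibredManifold n m E N} (γ : P.EhresmannConnection) (e : E) :
    P.TE e →L[ℝ] P.Vert e :=
  (γ.toFun e).codRestrict (P.Vert e) (γ.mem_vert e)

/-- The `V(p)`-valued `1`-form `(p¹₀)^*γ - θ` on `J¹E`. -/
def connectionDiff (P : FibredManifold n m E N) (γ : P.EhresmannConnection) (j : P.Jet) :
    P.TJ j →L[ℝ] P.Vert j.pt :=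
  (γ.toVert j.pt).comp (P.dtoTotal j) - P.contactForm j

/-- The form `(p¹₀)^*γ - θ` is `p¹`-horizontal; this is the element of `T^*_x N ⊗ V_e(p)` which it
defines at a jet, see `connectionDiff_apply`. -/
def connectionDiffHom (P : FibredManifold n m E N) (γ : P.EhresmannConnection) (j : P.Jet) :
    P.TN j.pt →L[ℝ] P.Vert j.pt :=
  (γ.toVert j.pt).comp j.lift

/-- The value of `(p¹₀)^*γ - θ` on `Z` is that of `connectionDiffHom` on `(p¹)_* Z`. -/
theorem connectionDiff_apply (P : FibredManifold n m E N) (γ : P.EhresmannConnection) (j : P.Jet)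
    (Z : P.TJ j) :
    P.connectionDiff γ j Z = P.connectionDiffHom γ j (P.dproj j.pt (P.dtoTotal j Z)) := by
  have h := γ.apply_vert j.pt _ (P.contactForm j Z).2
  apply Subtype.ext
  have h1 : ((P.contactForm j Z : P.Vert j.pt) : P.TE j.pt) =
    P.dtoTotal j Z - j.lift (P.dproj j.pt (P.dtoTotal j Z)) := rfl
  have h2 : ((P.connectionDiff γ j Z : P.Vert j.pt) : P.TE j.pt) =
    γ.toFun j.pt (P.dtoTotal j Z) - P.contactForm j Z := rfl
  have h3 : ((P.connectionDiffHom γ j (P.dproj j.pt (P.dtoTotal j Z)) : P.Vert j.pt) :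
    P.TE j.pt) = γ.toFun j.pt (j.lift (P.dproj j.pt (P.dtoTotal j Z))) := rfl
  rw [h2, h3, ← h, h1, map_sub]
  abel

/-- The vertical space `V_e(p)` with the norm inherited from the model space of `T_e E`. -/
def VertModel (P : FibredManifold n m E N) (e : E) : Submodule ℝ (Eu (m + n)) := P.Vert e

/-- The space `T^*_{p(e)} N ⊗ V_e(p) = Hom(T_{p(e)} N, V_e(p))`, on which the fibre of `p¹₀` over `e`
is modelled. -/
abbrev VertHom (P : FibredManifold n m E N) (e : E) : Type := Eu n →L[ℝ] P.VertModel e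

/-- The affine structure of the fibres of `p¹₀`: the jet `j + h`. -/
def translate (P : FibredManifold n m E N) (j : P.Jet) (h : P.TN j.pt →L[ℝ] P.Vert j.pt) :
    P.Jet where
  pt := j.pt
  lift := j.lift + (P.Vert j.pt).subtypeL.comp h
  dproj_lift v := by
    have h0 : P.dproj j.pt (h v : P.TE j.pt) = 0 := (h v).2
    simp [j.dproj_lift, h0]

/-- The natural isomorphism of `T^*_x N ⊗ V_e(p)` onto the `p¹₀`-vertical tangent space `V_j(p¹₀)`:
the vector `h` goes to the velocity of `t ↦ j + t h` at `t = 0`. -/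
def vertLift (P : FibredManifold n m E N) (j : P.Jet) : P.VertHom j.pt →L[ℝ] P.TJ j :=
  mfderiv 𝓘(ℝ, P.VertHom j.pt) 𝓘(ℝ, JetModel n m) (fun h : P.VertHom j.pt => P.translate j h) 0

/-- The differential of a function on `J¹E`. -/
def dLagrangian (P : FibredManifold n m E N) (L : P.Jet → ℝ) (j : P.Jet) : P.TJ j →L[ℝ] ℝ :=
  mfderiv 𝓘(ℝ, JetModel n m) 𝓘(ℝ, ℝ) L j

/-- The pairing `⟨h, dL|_{V(p¹₀)}⟩` of `h ∈ T^*_x N ⊗ V_e(p) ≅ V_j(p¹₀)` with the restriction of `dL`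
to `V(p¹₀)`. -/
def vertPairing (P : FibredManifold n m E N) (L : P.Jet → ℝ) (j : P.Jet)
    (h : P.TN j.pt →L[ℝ] P.Vert j.pt) : ℝ :=
  P.dLagrangian L j (P.vertLift j h)

/-- The covector `(∂L/∂y^α_i) dy^α` on `V_e(p)`, i.e. `w ↦ ⟨dxⁱ ⊗ w, dL|_{V(p¹₀)}⟩`, where `dxⁱ` is the
standard basis of `T^*_x N` (with `T_x N` identified with `ℝⁿ`). -/
def partialDeriv (P : FibredManifold n m E N) (L : P.Jet → ℝ) (j : P.Jet) (i : Fin n) :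
    P.Vert j.pt →ₗ[ℝ] ℝ :=
  ((P.dLagrangian L j).comp ((P.vertLift j).comp
    (ContinuousLinearMap.smulRightL ℝ (Eu n) (P.VertModel j.pt)
      (EuclideanSpace.proj i)))).toLinearMap

/-- The Legendre form `ω_Λ = (∂L/∂y^α_i) i_{∂/∂xⁱ} v_n ⊗ dy^α` of `Λ = L v_n`, a `p¹`-horizontal
`(n-1)`-form on `J¹E` with values in `V^*(p)`. -/
def legendreForm (P : FibredManifold n m E N) (v : VolumeForm n N) (L : P.Jet → ℝ) (j : P.Jet) :
    P.Vert j.pt →ₗ[ℝ] P.TJ j [⋀^Fin (n - 1)]→ₗ[ℝ] ℝ :=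
  ∑ i : Fin n, (P.partialDeriv L j i).smulRight
    ((interiorProduct (EuclideanSpace.single i 1 : Eu n) (v.toFun (P.toBase j))).compLinearMap
      (P.dtoBase j).toLinearMap)

/-- The Lagrangian density `Λ = L v_n` as an `n`-form on `J¹E`. -/
def density (P : FibredManifold n m E N) (v : VolumeForm n N) (L : P.Jet → ℝ) (j : P.Jet) :
    P.TJ j [⋀^Fin n]→ₗ[ℝ] ℝ :=
  L j • (v.toFun (P.toBase j)).compLinearMap (P.dtoBase j).toLinearMap

/-- The covariant Hamiltonian `Λ^γ = ((p¹₀)^*γ - θ) ∧ ω_Λ - Λ` of `Λ = L v_n`. -/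
def covariantHamiltonian (P : FibredManifold n m E N) (γ : P.EhresmannConnection)
    (v : VolumeForm n N) (L : P.Jet → ℝ) (j : P.Jet) : P.TJ j [⋀^Fin n]→ₗ[ℝ] ℝ :=
  wedgeDual (P.connectionDiff γ j).toLinearMap (P.legendreForm v L j) - P.density v L j

/-- The Poincaré–Cartan form `Θ_Λ = θ ∧ ω_Λ + Λ` of `Λ = L v_n`. -/
def poincareCartan (P : FibredManifold n m E N)
    (v : VolumeForm n N) (L : P.Jet → ℝ) (j : P.Jet) : P.TJ j [⋀^Fin n]→ₗ[ℝ] ℝ :=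
  wedgeDual (P.contactForm j).toLinearMap (P.legendreForm v L j) + P.density v L j

/-- A form on `J¹E` projects onto `E` if it is the pull-back of a smooth form on `E`. -/
def ProjectsOntoTotal (P : FibredManifold n m E N) {k : ℕ}
    (Θ : ∀ j : P.Jet, P.TJ j [⋀^Fin k]→ₗ[ℝ] ℝ) : Prop :=
  ∃ η : ∀ e : E, P.TE e [⋀^Fin k]→ₗ[ℝ] ℝ, IsSmoothForm η ∧
    ∀ j, Θ j = (η j.pt).compLinearMap (P.dtoTotal j).toLinearMap

end FibredManifold
end

set_option linter.unusedSectionVars false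

/-! The form `(p¹₀)^*γ - θ` is horizontal, so at each jet it is a linear map `h : T_x N → V_e(p)`.
Contracting `h` with the momenta `∂L/∂y^α_i` gives an endomorphism of `T_x N`, and wedging with
`ω_Λ` lets this endomorphism act on `v_n` as a derivation, that is, by its trace. The trace is `⟨h,
dL⟩`, hence `L^γ = ⟨(p¹₀)^*γ - θ, dL⟩ - L` (`covariantHamiltonian_eq`). So `L^γ = 0` is condition
(ii), and what remains is that (ii) implies (i).

Take as origin of the affine fibre of `p¹₀` over `e` the `γ`-horizontal jet. There (ii) is Euler's
identity for functions homogeneous of degree one. Since `L` is differentiable at the origin as well,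
it is linear on the fibre (`fderiv_eq_of_fderiv_apply_self`), so its momenta do not depend on the
jet over `e` (`momentum_eq`).

Finally (ii) says `Λ = ((p¹₀)^*γ - θ) ∧ ω_Λ`, whence `Θ_Λ = (p¹₀)^*γ ∧ ω_Λ` (`poincareCartan_eq`).
The right side descends to `E` because the momenta do, and the descended form is smooth by its
expression in fibred coordinates (`isSmoothForm_projectedForm`). -/

/-! ### Multilinear algebra: the trace formula for top-degree forms. -/

theorem AlternatingMap.finset_sum_apply {V : Type*} [AddCommGroup V] [Module ℝ V] {k : ℕ}
    {ι : Type*} (s : Finset ι) (f : ι → V [⋀^Fin k]→ₗ[ℝ] ℝ) (Z : Fin k → V) :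
    (∑ i ∈ s, f i) Z = ∑ i ∈ s, f i Z :=
  map_sum (⟨⟨fun g => g Z, rfl⟩, fun _ _ => rfl⟩ : V [⋀^Fin k]→ₗ[ℝ] ℝ →+ ℝ) f s

/-- The interior product puts `b i` in the first slot, and the sign `(-1)^p` of the exterior product
is the one that moves it to slot `p`. In degree `0` both sides vanish, the right one as an empty
sum. -/
theorem wedgeDual_interiorProduct_apply {V W F : Type*} [AddCommGroup V] [Module ℝ V]
    [AddCommGroup W] [Module ℝ W] [AddCommGroup F] [Module ℝ F] {k : ℕ} {ι : Type*} [Fintype ι]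
    (β : V →ₗ[ℝ] W) (c : ι → W →ₗ[ℝ] ℝ) (b : ι → F) (v : F [⋀^Fin k]→ₗ[ℝ] ℝ) (T : V →ₗ[ℝ] F)
    (Z : Fin k → V) :
    wedgeDual β (∑ i, (c i).smulRight ((interiorProduct (b i) v).compLinearMap T)) Z =
      ∑ p, v (Function.update (fun q => T (Z q)) p (∑ i, c i (β (Z p)) • b i)) := by
  cases k with
  | zero => simp [wedgeDual]
  | succ k =>
    rw [wedgeDual, AlternatingMap.alternatizeUncurryFin_apply]
    refine Finset.sum_congr rfl fun p _ => ?_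
    rw [AlternatingMap.map_update_sum, LinearMap.comp_apply, LinearMap.sum_apply,
      AlternatingMap.finset_sum_apply, Finset.smul_sum]
    refine Finset.sum_congr rfl fun i _ => ?_
    rw [AlternatingMap.map_update_smul, ← Fin.insertNth_removeNth, AlternatingMap.map_insertNth,
      LinearMap.smulRight_apply, AlternatingMap.smul_apply, smul_comm]
    rfl

/-- A derivation acts on top-degree forms by its trace. -/
theorem sum_map_update_linearMap {n : ℕ} {F : Type*} [AddCommGroup F] [Module ℝ F]
    (b : Module.Basis (Fin n) ℝ F) (v : F [⋀^Fin n]→ₗ[ℝ] ℝ) (B : F →ₗ[ℝ] F) (X : Fin n → F) :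
    ∑ p, v (Function.update X p (B (X p))) = (∑ i, b.repr (B (b i)) i) * v X := by
  -- Writing the sum as an exterior product shows that it is alternating in `X`. It is then a
  -- multiple of `b.det`, and only its value on `b` has to be computed.
  have key : ∀ X : Fin n → F, wedgeDual B (∑ i, (b.coord i).smulRight
      ((interiorProduct (b i) v).compLinearMap LinearMap.id)) X =
        ∑ p, v (Function.update X p (B (X p))) := by
    intro X
    rw [wedgeDual_interiorProduct_apply]
    simp [b.sum_repr]
  have h1 := AlternatingMap.eq_smul_basis_det b (wedgeDual B (∑ i, (b.coord i).smulRight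
      ((interiorProduct (b i) v).compLinearMap LinearMap.id)))
  have h2 := DFunLike.congr_fun (v.eq_smul_basis_det b) X
  rw [AlternatingMap.smul_apply] at h2
  rw [← key X, h1, AlternatingMap.smul_apply, key, h2, smul_eq_mul, smul_eq_mul, ← mul_assoc]
  congr 1
  rw [Finset.sum_mul]
  refine Finset.sum_congr rfl fun p _ => ?_
  conv_lhs => rw [← b.sum_repr (B (b p)), AlternatingMap.map_update_sum]
  rw [Finset.sum_eq_single p]
  · rw [AlternatingMap.map_update_smul, Function.update_eq_self, smul_eq_mul]
  -- Off the diagonal, `b q` stands in both slots `p` and `q`.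
  · intro q _ hq
    rw [AlternatingMap.map_update_smul,
      v.map_eq_zero_of_eq _ (i := p) (j := q) (by simp [Function.update_of_ne hq]) hq.symm,
      smul_zero]
  · simp

/-! ### Euler's identity and linearity. -/

/-- A differentiable function with `Dg(x) x = g(x)` is linear. -/
theorem fderiv_eq_of_fderiv_apply_self {G : Type*} [NormedAddCommGroup G] [NormedSpace ℝ G]
    {g : G → ℝ} (hg : Differentiable ℝ g) (h : ∀ x, fderiv ℝ g x x = g x) (x : G) :
    fderiv ℝ g x = fderiv ℝ g 0 := by
  suffices hlin : g = fderiv ℝ g 0 by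
    conv_lhs => rw [hlin]
    exact (fderiv ℝ g 0).fderiv
  funext y
  have hd : ∀ t : ℝ, HasDerivAt (fun t : ℝ => g (t • y)) (fderiv ℝ g (t • y) y) t := by
    intro t
    have h1 : HasDerivAt (fun t : ℝ => t • y) y t := by
      simpa using (hasDerivAt_id t).smul_const y
    exact (hg (t • y)).hasFDerivAt.comp_hasDerivAt t h1
  have h0 : g 0 = 0 := by simpa using (h 0).symm
  -- The derivative of `t⁻¹ g(ty)` is `-t⁻² g(ty) + t⁻¹ Dg(ty) y`, which Euler's identity at `ty`
  -- makes zero; the constant is read off at `t = 1`.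
  have hconst : ∀ t : ℝ, t ∈ Ioi (0 : ℝ) → t⁻¹ * g (t • y) = g y := by
    have hD : ∀ t ∈ Ioi (0 : ℝ), HasDerivAt (fun t : ℝ => t⁻¹ * g (t • y)) 0 t := by
      intro t ht
      have ht' : t ≠ 0 := ne_of_gt ht
      have h3 := h (t • y)
      rw [map_smul, smul_eq_mul] at h3
      have h4 : -(t ^ 2)⁻¹ * g (t • y) + t⁻¹ * (fderiv ℝ g (t • y)) y = 0 := by
        rw [← h3]
        field_simp
        ring
      exact h4 ▸ (hasDerivAt_inv ht').mul (hd t)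
    intro t ht
    have := (convex_Ioi (0 : ℝ)).is_const_of_fderivWithin_eq_zero (𝕜 := ℝ)
      (fun s hs => (hD s hs).differentiableAt.differentiableWithinAt)
      (fun s hs => by
        rw [fderivWithin_of_isOpen isOpen_Ioi hs]
        ext
        simp [(hD s hs).deriv]) ht (show (1 : ℝ) ∈ Ioi (0 : ℝ) from one_pos (α := ℝ))
    simpa using this
  -- Differentiability at the origin is what excludes nonlinear homogeneous functions: the
  -- difference quotient along `y` is constantly `g y` and tends to `Dg(0) y`.
  have hlim := (hd 0).tendsto_slope_zero_right
  have hlim' : Filter.Tendsto (fun t : ℝ => t⁻¹ • (g ((0 + t) • y) - g ((0 : ℝ) • y)))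
      (𝓝[>] 0) (𝓝 (g y)) := by
    refine tendsto_const_nhds.congr' ?_
    filter_upwards [self_mem_nhdsWithin] with t ht
    rw [zero_add, zero_smul, h0, sub_zero, smul_eq_mul, hconst t ht]
  simpa using tendsto_nhds_unique hlim' hlim

/-- If a function is homogeneous of degree one along an affine subspace, with respect to a point of
that subspace, then its differential along the subspace is constant. -/
theorem fderiv_apply_eq_of_homogeneous_on_affine {G H : Type*} [NormedAddCommGroup G]
    [NormedSpace ℝ G] [NormedAddCommGroup H] [NormedSpace ℝ H] {F : H → ℝ} {q : H} {A : G →L[ℝ] H}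
    (hF : ∀ k, DifferentiableAt ℝ F (q + A k))
    (h : ∀ k, fderiv ℝ F (q + A k) (A k) = F (q + A k)) (k w : G) :
    fderiv ℝ F (q + A k) (A w) = fderiv ℝ F q (A w) := by
  have hd : ∀ k, HasFDerivAt (fun k => F (q + A k)) ((fderiv ℝ F (q + A k)).comp A) k := fun k =>
    (hF k).hasFDerivAt.comp k (A.hasFDerivAt.const_add q)
  have h1 := fderiv_eq_of_fderiv_apply_self (fun k => (hd k).differentiableAt)
    (fun k => by rw [(hd k).fderiv]; exact h k) k
  rw [(hd k).fderiv, (hd 0).fderiv, map_zero, add_zero] at h1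
  exact DFunLike.congr_fun h1 w

theorem contDiffOn_det {ι F G : Type*} [Fintype ι] [DecidableEq ι] [NormedAddCommGroup F]
    [NormedSpace ℝ F] [FiniteDimensional ℝ F] [NormedAddCommGroup G] [NormedSpace ℝ G]
    (b : Module.Basis ι ℝ F) {s : Set G} {ξ : G → ι → F}
    (hξ : ∀ i, ContDiffOn ℝ ∞ (fun a => ξ a i) s) :
    ContDiffOn ℝ ∞ (fun a => b.det (ξ a)) s := by
  have h : ∀ i j, ContDiffOn ℝ ∞ (fun a => b.repr (ξ a i) j) s := fun i j =>
    ((b.coord j).toContinuousLinearMap.contDiff).comp_contDiffOn (hξ i)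
  simp only [Module.Basis.det_apply, Matrix.det_apply', Module.Basis.toMatrix_apply]
  exact ContDiffOn.sum fun σ _ => contDiffOn_const.mul (contDiffOn_prod fun i _ => h _ _)

/-! ### Induced coordinates on the jet manifold and derivatives along the fibres. -/

noncomputable section

namespace FibredManifold

variable {n m : ℕ} {E N : Type*}
  [TopologicalSpace E] [ChartedSpace (Eu (m + n)) E]
  [TopologicalSpace N] [ChartedSpace (Eu n) N]
  [IsManifold 𝓘(ℝ, Eu (m + n)) ∞ E] [IsManifold 𝓘(ℝ, Eu n) ∞ N]
  {P : FibredManifold n m E N}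

namespace FibredChart

variable (c : P.FibredChart)

/-- The chart of `J¹E` induced by a fibred coordinate system, as a homeomorphism. -/
def jetHomeo : OpenPartialHomeomorph P.Jet (JetModel n m) :=
  P.jetCore.openPartialHomeomorph c.jetChart (mem_range_self c)

theorem jetHomeo_mem_atlas : c.jetHomeo ∈ atlas (JetModel n m) P.Jet :=
  mem_iUnion₂.2 ⟨c.jetChart, mem_range_self c, rfl⟩

theorem jetHomeo_apply (j : P.Jet) : c.jetHomeo j = c.jetCoord j := rfl

theorem mdiff_jetHomeo : c.jetHomeo.MDifferentiable 𝓘(ℝ, JetModel n m) 𝓘(ℝ, JetModel n m) :=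
  mdifferentiable_of_mem_atlas c.jetHomeo_mem_atlas

theorem contDiffOn_comp_jetHomeo_symm {L : P.Jet → ℝ}
    (hL : ContMDiff 𝓘(ℝ, JetModel n m) 𝓘(ℝ, ℝ) ∞ L) :
    ContDiffOn ℝ ∞ (L ∘ c.jetHomeo.symm) c.jetHomeo.target := by
  rw [← contMDiffOn_iff_contDiffOn]
  exact hL.comp_contMDiffOn (contMDiffOn_symm_of_mem_maximalAtlas
    (IsManifold.subset_maximalAtlas c.jetHomeo_mem_atlas))

/-- In induced coordinates `p¹₀` forgets the `y^α_i`, so near `j` it is `c.total.symm ∘ Prod.fst ∘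
c.jetHomeo`. -/
theorem hasMFDerivAt_toTotal {j : P.Jet} (hj : j.pt ∈ c.total.source) :
    HasMFDerivAt 𝓘(ℝ, JetModel n m) 𝓘(ℝ, Eu (m + n)) P.toTotal j
      ((c.dtotalSymm (c.total j.pt)).comp ((ContinuousLinearMap.fst ℝ (Eu n × Eu m)
        (Eu n →L[ℝ] Eu m)).comp (mfderiv 𝓘(ℝ, JetModel n m) 𝓘(ℝ, JetModel n m) c.jetHomeo j :
          JetModel n m →L[ℝ] JetModel n m))) := by
  have h1 : HasMFDerivAt 𝓘(ℝ, JetModel n m) 𝓘(ℝ, JetModel n m) c.jetHomeo j _ :=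
    (c.mdiff_jetHomeo.mdifferentiableAt hj).hasMFDerivAt
  have h2 : HasMFDerivAt 𝓘(ℝ, JetModel n m) 𝓘(ℝ, Eu n × Eu m)
      (Prod.fst : JetModel n m → Eu n × Eu m) (c.jetHomeo j)
      (ContinuousLinearMap.fst ℝ (Eu n × Eu m) (Eu n →L[ℝ] Eu m)) :=
    hasFDerivAt_fst.hasMFDerivAt
  have h3 : HasMFDerivAt 𝓘(ℝ, Eu n × Eu m) 𝓘(ℝ, Eu (m + n)) c.total.symm (c.jetHomeo j).1
      (c.dtotalSymm (c.total j.pt)) :=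
    (c.mdiff_total.symm.mdifferentiableAt (c.total.map_source hj)).hasMFDerivAt
  refine (h3.comp j (h2.comp j h1)).congr_of_eventuallyEq ?_
  filter_upwards [c.jetHomeo.open_source.mem_nhds hj] with k hk
  exact (c.total.left_inv hk).symm

end FibredChart

theorem mdifferentiableAt_toTotal (j : P.Jet) :
    MDifferentiableAt 𝓘(ℝ, JetModel n m) 𝓘(ℝ, Eu (m + n)) P.toTotal j := by
  obtain ⟨c, hc⟩ := P.exists_fibredChart j.pt
  exact (c.hasMFDerivAt_toTotal hc).mdifferentiableAt

theorem dtoTotal_surjective (j : P.Jet) : Function.Surjective (P.dtoTotal j) := by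
  obtain ⟨c, hc⟩ := P.exists_fibredChart j.pt
  intro Y
  obtain ⟨Z, hZ⟩ := (c.mdiff_jetHomeo.mfderiv_surjective (x := j) hc)
    ((c.dtotal j.pt Y, 0) : JetModel n m)
  refine ⟨Z, ?_⟩
  rw [dtoTotal, (c.hasMFDerivAt_toTotal hc).mfderiv]
  refine Eq.trans ?_ (c.dtotalSymm_dtotal hc Y)
  change c.dtotalSymm (c.total j.pt) (Prod.fst (mfderiv 𝓘(ℝ, JetModel n m) 𝓘(ℝ, JetModel n m)
    c.jetHomeo j Z : JetModel n m)) = _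
  exact congrArg (fun q : JetModel n m => c.dtotalSymm (c.total j.pt) q.1) hZ

theorem dtoBase_apply (j : P.Jet) (Z : P.TJ j) :
    P.dtoBase j Z = P.dproj j.pt (P.dtoTotal j Z) := by
  have h := ((P.mdifferentiable_proj j.pt).hasMFDerivAt).comp j
    (mdifferentiableAt_toTotal j).hasMFDerivAt
  exact DFunLike.congr_fun h.mfderiv Z

theorem dtoBase_surjective (j : P.Jet) : Function.Surjective (P.dtoBase j) := by
  intro X
  obtain ⟨Z, hZ⟩ := dtoTotal_surjective j (j.lift X)
  exact ⟨Z, by rw [dtoBase_apply, hZ, j.dproj_lift]⟩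

theorem translate_zero (j : P.Jet) : P.translate j 0 = j := by
  refine Jet.ext' rfl ?_
  ext1 x
  exact add_zero (j.lift x)

namespace FibredChart

variable (c : P.FibredChart)

/-- Chain rule for `L` along a family of jets that is affine in induced coordinates; it serves for
the family `h ↦ j + h` defining `vertLift`. -/
theorem dLagrangian_mfderiv_jetHomeo_symm {G : Type*} [NormedAddCommGroup G] [NormedSpace ℝ G]
    {L : P.Jet → ℝ} (hL : ContMDiff 𝓘(ℝ, JetModel n m) 𝓘(ℝ, ℝ) ∞ L) {q : JetModel n m}
    (A : G →L[ℝ] JetModel n m) {T : G → P.Jet} (hT : ∀ h, T h = c.jetHomeo.symm (q + A h))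
    (hq : q ∈ c.jetHomeo.target) (k : G) :
    mfderiv 𝓘(ℝ, JetModel n m) 𝓘(ℝ, ℝ) L (T 0)
      (mfderiv 𝓘(ℝ, G) 𝓘(ℝ, JetModel n m) T 0 k) =
      fderiv ℝ (L ∘ c.jetHomeo.symm) q (A k) := by
  have h1 : HasFDerivAt (fun k => q + A k) A 0 := A.hasFDerivAt.const_add q
  have hq0 : q + A 0 = q := by simp
  have hq' : q + A 0 ∈ c.jetHomeo.target := by rwa [hq0]
  have h2 : MDifferentiableAt 𝓘(ℝ, G) 𝓘(ℝ, JetModel n m) T 0 :=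
    ((c.mdiff_jetHomeo.symm.mdifferentiableAt hq').comp (0 : G)
      h1.hasMFDerivAt.mdifferentiableAt).congr_of_eventuallyEq (Filter.Eventually.of_forall hT)
  have h3 := ((hL.mdifferentiable (by simp) (T 0)).hasMFDerivAt).comp (0 : G) h2.hasMFDerivAt
  have h4 : HasFDerivAt (L ∘ c.jetHomeo.symm) (fderiv ℝ (L ∘ c.jetHomeo.symm) q) (q + A 0) := by
    rw [hq0]
    exact (((c.contDiffOn_comp_jetHomeo_symm hL).contDiffAt
      (c.jetHomeo.open_target.mem_nhds hq)).differentiableAt (by simp)).hasFDerivAt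
  have h6 := h4.comp (0 : G) h1
  have h5 : HasFDerivAt (L ∘ T) ((fderiv ℝ (L ∘ c.jetHomeo.symm) q).comp A) 0 :=
    h6.congr_of_eventuallyEq (Filter.Eventually.of_forall fun h => congrArg L (hT h))
  exact DFunLike.congr_fun (hasMFDerivAt_unique h3 h5.hasMFDerivAt) k

/-- The coordinates of a vector of `T^*_x N ⊗ V_e(p)`. -/
def vertCoord (e : E) : P.VertHom e →L[ℝ] (Eu n →L[ℝ] Eu m) :=
  (ContinuousLinearMap.postcomp (Eu n) ((ContinuousLinearMap.snd ℝ (Eu n) (Eu m)).comp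
      ((c.dtotal e).comp (P.VertModel e).subtypeL))).comp
    (ContinuousLinearMap.precomp (P.VertModel e) (c.dbaseSymm (c.base (P.proj e))))

theorem jetCoord_translate (j : P.Jet) (k : P.VertHom j.pt) :
    c.jetCoord (P.translate j k) = c.jetCoord j + (0, c.vertCoord j.pt k) := by
  refine Prod.ext (add_zero _).symm ?_
  ext1 x
  exact congrArg Prod.snd (map_add (c.dtotal j.pt)
    ((j.lift : Eu n →L[ℝ] Eu (m + n)) (c.dbaseSymm (c.base (P.proj j.pt)) x))
    (k (c.dbaseSymm (c.base (P.proj j.pt)) x) : Eu (m + n)))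

theorem translate_eq {j : P.Jet} (hj : j.pt ∈ c.total.source) (k : P.VertHom j.pt) :
    P.translate j k = c.jetHomeo.symm (c.jetCoord j + (0, c.vertCoord j.pt k)) := by
  rw [← c.jetCoord_translate]
  exact (c.jetHomeo.left_inv (x := P.translate j k) hj).symm

/-- The induced coordinates of a `p¹₀`-vertical vector. -/
def vertJetCoord (e : E) : P.VertHom e →L[ℝ] JetModel n m :=
  (ContinuousLinearMap.inr ℝ (Eu n × Eu m) (Eu n →L[ℝ] Eu m)).comp (c.vertCoord e)

theorem dLagrangian_vertLift {L : P.Jet → ℝ}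
    (hL : ContMDiff 𝓘(ℝ, JetModel n m) 𝓘(ℝ, ℝ) ∞ L) {j : P.Jet} (hj : j.pt ∈ c.total.source)
    (k : P.VertHom j.pt) :
    P.dLagrangian L j (P.vertLift j k) =
      fderiv ℝ (L ∘ c.jetHomeo.symm) (c.jetCoord j) (c.vertJetCoord j.pt k) := by
  have h := c.dLagrangian_mfderiv_jetHomeo_symm hL (c.vertJetCoord j.pt)
    (T := fun h : P.VertHom j.pt => P.translate j h) (c.translate_eq hj)
    (c.jetHomeo.map_source (x := j) hj) k
  -- The chain rule is based at `j + 0`, which equals `j` but not definitionally; the differential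
  -- of `L` is transported along this equality.
  have h0 : P.translate j 0 = j := translate_zero j
  refine Eq.trans ?_ h
  exact congrArg (fun i : P.Jet => (mfderiv 𝓘(ℝ, JetModel n m) 𝓘(ℝ, ℝ) L i :
    JetModel n m →L[ℝ] ℝ) (P.vertLift j k : JetModel n m)) h0.symm

end FibredChart

/-- If `L` is homogeneous of degree one along a fibre of `p¹₀` with respect to the jet `j`, then the
differential of `L` along the fibre is constant. -/
theorem dLagrangian_vertLift_translate {L : P.Jet → ℝ}
    (hL : ContMDiff 𝓘(ℝ, JetModel n m) 𝓘(ℝ, ℝ) ∞ L) (j : P.Jet)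
    (h : ∀ k : P.VertHom j.pt,
      P.dLagrangian L (P.translate j k) (P.vertLift (P.translate j k) k) = L (P.translate j k))
    (k w : P.VertHom j.pt) :
    P.dLagrangian L (P.translate j k) (P.vertLift (P.translate j k) w) =
      P.dLagrangian L j (P.vertLift j w) := by
  obtain ⟨c, hj⟩ := P.exists_fibredChart j.pt
  have hd : ∀ k w : P.VertHom j.pt,
      P.dLagrangian L (P.translate j k) (P.vertLift (P.translate j k) w) =
      fderiv ℝ (L ∘ c.jetHomeo.symm) (c.jetCoord j + c.vertJetCoord j.pt k)
        (c.vertJetCoord j.pt w) := by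
    intro k w
    refine (c.dLagrangian_vertLift hL (j := P.translate j k) hj w).trans ?_
    rw [c.jetCoord_translate]
    rfl
  refine (hd k w).trans (Eq.trans ?_ (c.dLagrangian_vertLift hL hj w).symm)
  refine fderiv_apply_eq_of_homogeneous_on_affine (fun k => ?_) (fun k => ?_) k w
  · have hk : c.jetCoord j + c.vertJetCoord j.pt k ∈ c.jetHomeo.target := by
      have := c.jetHomeo.map_source (x := P.translate j k) hj
      rwa [c.jetHomeo_apply, c.jetCoord_translate] at this
    exact ((c.contDiffOn_comp_jetHomeo_symm hL).contDiffAt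
      (c.jetHomeo.open_target.mem_nhds hk)).differentiableAt (by simp)
  · rw [← hd]
    exact (h k).trans (congrArg L (c.translate_eq hj k))

end FibredManifold

end

/-! ### Momenta and the function `L^γ`. -/

noncomputable section

namespace FibredManifold

variable {n m : ℕ} {E N : Type*}
  [TopologicalSpace E] [ChartedSpace (Eu (m + n)) E]
  [TopologicalSpace N] [ChartedSpace (Eu n) N]
  [IsManifold 𝓘(ℝ, Eu (m + n)) ∞ E] [IsManifold 𝓘(ℝ, Eu n) ∞ N]
  {P : FibredManifold n m E N}

/-- The vector `w ↦ (∂L/∂y^α_i) w^α ∂/∂xⁱ` with values in `T_x N`. -/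
def momentum (L : P.Jet → ℝ) (j : P.Jet) : P.Vert j.pt →ₗ[ℝ] Eu n :=
  ∑ i, (P.partialDeriv L j i).smulRight (EuclideanSpace.single i 1 : Eu n)

theorem momentum_eq_sum (L : P.Jet → ℝ) (j : P.Jet) (w : P.Vert j.pt) :
    momentum L j w = ∑ i, P.partialDeriv L j i w • (EuclideanSpace.single i 1 : Eu n) := by
  simp [momentum, LinearMap.sum_apply]

theorem momentum_apply (L : P.Jet → ℝ) (j : P.Jet) (w : P.Vert j.pt) (i : Fin n) :
    momentum L j w i = P.partialDeriv L j i w := by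
  rw [momentum_eq_sum]
  simp [Finset.sum_apply, Pi.single_apply]

theorem wedgeDual_legendreForm_apply (v : VolumeForm n N) (L : P.Jet → ℝ) (j : P.Jet)
    (β : P.TJ j →ₗ[ℝ] P.Vert j.pt) (Z : Fin n → P.TJ j) :
    wedgeDual β (P.legendreForm v L j) Z = ∑ p, v.toFun (P.toBase j)
      (Function.update (fun q => P.dtoBase j (Z q)) p (momentum L j (β (Z p)))) := by
  simp only [momentum_eq_sum]
  exact wedgeDual_interiorProduct_apply (F := Eu n) β (P.partialDeriv L j)
    (fun i => EuclideanSpace.single i 1) (v.toFun (P.toBase j)) (P.dtoBase j).toLinearMap Z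

/-- Linearity applied to `h = ∑ dxⁱ ⊗ h(∂/∂xⁱ)`. -/
theorem sum_partialDeriv (L : P.Jet → ℝ) (j : P.Jet) (h : P.VertHom j.pt) :
    ∑ i, P.partialDeriv L j i (h (EuclideanSpace.single i 1)) =
      P.dLagrangian L j (P.vertLift j h) := by
  have hs : h = ∑ i, (EuclideanSpace.proj i : Eu n →L[ℝ] ℝ).smulRight
      (h (EuclideanSpace.single i 1)) := by
    ext1 x
    conv_lhs => rw [← (EuclideanSpace.basisFun (Fin n) ℝ).sum_repr x]
    simp
  have hl : ∀ f : Fin n → P.VertHom j.pt, P.dLagrangian L j (P.vertLift j (∑ i, f i)) =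
      ∑ i, P.dLagrangian L j (P.vertLift j (f i)) := fun f =>
    map_sum ((P.dLagrangian L j).comp (P.vertLift j)) f Finset.univ
  conv_rhs => rw [hs]
  rw [hl]
  rfl

/-- For horizontal `β` the vector substituted in slot `p` is the image of the vector already there
under the endomorphism `momentum L j ∘ h` of `T_x N`. The trace formula applies, and by
`sum_partialDeriv` the trace is the pairing of `h` with `dL`. -/
theorem wedgeDual_horizontal_legendreForm (v : VolumeForm n N) (L : P.Jet → ℝ) (j : P.Jet)
    (β : P.TJ j →ₗ[ℝ] P.Vert j.pt) (h : P.VertHom j.pt) (hβ : ∀ Z, β Z = h (P.dtoBase j Z))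
    (Z : Fin n → P.TJ j) :
    wedgeDual β (P.legendreForm v L j) Z = P.dLagrangian L j (P.vertLift j h) *
      v.toFun (P.toBase j) (fun q => P.dtoBase j (Z q)) := by
  rw [wedgeDual_legendreForm_apply]
  have ht := sum_map_update_linearMap (EuclideanSpace.basisFun (Fin n) ℝ).toBasis
    (v.toFun (P.toBase j) : Eu n [⋀^Fin n]→ₗ[ℝ] ℝ)
    ((momentum L j : P.VertModel j.pt →ₗ[ℝ] Eu n) ∘ₗ h.toLinearMap)
    (fun q => P.dtoBase j (Z q))
  have hc : ∑ i, (EuclideanSpace.basisFun (Fin n) ℝ).toBasis.repr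
      (((momentum L j : P.VertModel j.pt →ₗ[ℝ] Eu n) ∘ₗ h.toLinearMap)
        ((EuclideanSpace.basisFun (Fin n) ℝ).toBasis i)) i =
      P.dLagrangian L j (P.vertLift j h) := by
    rw [← sum_partialDeriv]
    refine Finset.sum_congr rfl fun i _ => ?_
    refine Eq.trans ?_ (momentum_apply L j (h (EuclideanSpace.single i 1)) i)
    change (EuclideanSpace.basisFun (Fin n) ℝ).toBasis.repr
      (momentum L j (h ((EuclideanSpace.basisFun (Fin n) ℝ).toBasis i))) i = _
    rw [OrthonormalBasis.coe_toBasis, EuclideanSpace.basisFun_apply]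
    rfl
  rw [hc] at ht
  refine Eq.trans (Finset.sum_congr rfl fun p _ => ?_) ht
  rw [hβ]
  rfl

theorem covariantHamiltonian_eq (γ : P.EhresmannConnection) (v : VolumeForm n N) (L : P.Jet → ℝ)
    (j : P.Jet) : P.covariantHamiltonian γ v L j =
      P.density v (fun j => P.vertPairing L j (P.connectionDiffHom γ j) - L j) j := by
  ext Z
  have h := wedgeDual_horizontal_legendreForm v L j (P.connectionDiff γ j).toLinearMap
    (P.connectionDiffHom γ j) (fun Z => by
      rw [dtoBase_apply]
      exact P.connectionDiff_apply γ j Z) Z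
  rw [covariantHamiltonian, AlternatingMap.sub_apply, h]
  exact (sub_mul _ _ _).symm

/-- Since `p¹` is a submersion, vectors on which `v_n` does not vanish lift to `J¹E`. This gives the
uniqueness of `L^γ`. -/
theorem density_injective (v : VolumeForm n N) {H H' : P.Jet → ℝ} {j : P.Jet}
    (h : P.density v H j = P.density v H' j) : H j = H' j := by
  obtain ⟨X, hX⟩ : ∃ X, v.toFun (P.toBase j) X ≠ 0 := by
    by_contra! h0
    exact v.ne_zero _ (AlternatingMap.ext h0)
  choose Z hZ using fun i => dtoBase_surjective j (X i)
  have h1 : H j * v.toFun (P.toBase j) (fun q => P.dtoBase j (Z q)) =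
    H' j * v.toFun (P.toBase j) (fun q => P.dtoBase j (Z q)) := DFunLike.congr_fun h Z
  rw [show (fun q => P.dtoBase j (Z q)) = X from funext hZ] at h1
  exact mul_right_cancel₀ hX h1

/-! ### Projection of the Poincaré–Cartan form -/

theorem exists_lift (P : FibredManifold n m E N) (e : E) :
    ∃ l : P.TN e →L[ℝ] P.TE e, ∀ x, P.dproj e (l x) = x := by
  obtain ⟨j, rfl⟩ := P.exists_jet e
  exact ⟨j.lift, j.dproj_lift⟩

/-- Some jet over a given point of `E`. -/
def jetOver (P : FibredManifold n m E N) (e : E) : P.Jet :=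
  ⟨e, (P.exists_lift e).choose, (P.exists_lift e).choose_spec⟩

theorem momentum_eq_of_dLagrangian_vertLift_eq {L : P.Jet → ℝ} {j : P.Jet}
    {l : P.TN j.pt →L[ℝ] P.TE j.pt} {hl : ∀ x, P.dproj j.pt (l x) = x}
    (h : ∀ w : P.VertHom j.pt, P.dLagrangian L ⟨j.pt, l, hl⟩ (P.vertLift ⟨j.pt, l, hl⟩ w) =
      P.dLagrangian L j (P.vertLift j w)) (w : P.Vert j.pt) :
    momentum L ⟨j.pt, l, hl⟩ w = momentum L j w := by
  ext i
  rw [momentum_apply, momentum_apply]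
  exact h ((EuclideanSpace.proj i : Eu n →L[ℝ] ℝ).smulRight (w : P.VertModel j.pt))

/-- Measured from a `γ`-horizontal jet, `(p¹₀)^*γ - θ` is the position vector in the fibre; this
turns (ii) into Euler's identity. -/
theorem connectionDiffHom_translate (γ : P.EhresmannConnection) {j : P.Jet}
    (h0 : ∀ x, γ.toFun j.pt (j.lift x) = 0) (k : P.TN j.pt →L[ℝ] P.Vert j.pt) :
    P.connectionDiffHom γ (P.translate j k) = k := by
  ext1 x
  apply Subtype.ext
  change γ.toFun j.pt (j.lift x + (k x : P.TE j.pt)) = k x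
  refine (map_add (γ.toFun j.pt) _ _).trans ?_
  refine (congrArg₂ (· + ·) (h0 x) (γ.apply_vert _ _ (k x).2)).trans (zero_add _)

theorem momentum_eq_of_horizontal (γ : P.EhresmannConnection) {L : P.Jet → ℝ}
    (hL : ContMDiff 𝓘(ℝ, JetModel n m) 𝓘(ℝ, ℝ) ∞ L)
    (h : ∀ j, L j = P.vertPairing L j (P.connectionDiffHom γ j)) {j : P.Jet}
    (h0 : ∀ x, γ.toFun j.pt (j.lift x) = 0) (l : P.TN j.pt →L[ℝ] P.TE j.pt)
    (hl : ∀ x, P.dproj j.pt (l x) = x) (w : P.Vert j.pt) :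
    momentum L ⟨j.pt, l, hl⟩ w = momentum L j w := by
  refine momentum_eq_of_dLagrangian_vertLift_eq (fun w => ?_) w
  let k : P.TN j.pt →L[ℝ] P.Vert j.pt := (l - j.lift).codRestrict (P.Vert j.pt)
    (fun x => by simp [hl, j.dproj_lift])
  have hk : P.translate j k = ⟨j.pt, l, hl⟩ := by
    refine Jet.ext' rfl ?_
    ext1 x
    exact add_sub_cancel (j.lift x) (l x)
  have h1 := dLagrangian_vertLift_translate hL j (fun k => by
    have h2 := h (P.translate j k)
    rw [connectionDiffHom_translate γ h0 k] at h2
    exact h2.symm) k w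
  -- The equality `hk` of jets is generalised so that the dependent tangent spaces can be rewritten
  -- along it.
  have h3 : ∀ i : P.Jet, i = P.translate j k → ∀ hi : i.pt = j.pt,
      P.dLagrangian L i (P.vertLift i (hi ▸ w : P.VertHom i.pt)) =
      P.dLagrangian L (P.translate j k) (P.vertLift (P.translate j k) w) := by
    rintro _ rfl _
    rfl
  exact (h3 _ hk.symm rfl).trans h1

/-- Every fibre contains a `γ`-horizontal jet `l₀`, obtained by subtracting the vertical part `γ ∘
j.lift`; both jets are compared with it. Writing the other jet as `⟨j.pt, l, hl⟩` keeps both momenta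
on the same space `P.Vert j.pt`. -/
theorem momentum_eq (γ : P.EhresmannConnection) {L : P.Jet → ℝ}
    (hL : ContMDiff 𝓘(ℝ, JetModel n m) 𝓘(ℝ, ℝ) ∞ L)
    (h : ∀ j, L j = P.vertPairing L j (P.connectionDiffHom γ j)) (j : P.Jet)
    (l : P.TN j.pt →L[ℝ] P.TE j.pt) (hl : ∀ x, P.dproj j.pt (l x) = x) (w : P.Vert j.pt) :
    momentum L ⟨j.pt, l, hl⟩ w = momentum L j w := by
  let l₀ : P.TN j.pt →L[ℝ] P.TE j.pt := j.lift - (γ.toFun j.pt).comp j.lift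
  have hl₀ : ∀ x, P.dproj j.pt (l₀ x) = x := fun x => by
    have h1 : P.dproj j.pt (γ.toFun j.pt (j.lift x)) = 0 := γ.mem_vert j.pt (j.lift x)
    change P.dproj j.pt (j.lift x - γ.toFun j.pt (j.lift x)) = x
    rw [map_sub, h1, sub_zero, j.dproj_lift]
  have h0 : ∀ x, γ.toFun j.pt (l₀ x) = 0 := fun x => by
    change γ.toFun j.pt (j.lift x - γ.toFun j.pt (j.lift x)) = 0
    rw [map_sub, γ.apply_vert _ _ (γ.mem_vert j.pt (j.lift x)), sub_self]
  exact (momentum_eq_of_horizontal γ hL h (j := ⟨j.pt, l₀, hl₀⟩) h0 l hl w).trans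
    (momentum_eq_of_horizontal γ hL h (j := ⟨j.pt, l₀, hl₀⟩) h0 j.lift j.dproj_lift w).symm

/-- The form `γ ∧ ω_Λ` on `E`, when the Legendre form `ω_Λ` projects onto `E`. -/
def projectedForm (γ : P.EhresmannConnection) (v : VolumeForm n N) (L : P.Jet → ℝ) (e : E) :
    P.TE e [⋀^Fin n]→ₗ[ℝ] ℝ :=
  wedgeDual (γ.toVert e).toLinearMap (∑ i : Fin n, (P.partialDeriv L (P.jetOver e) i).smulRight
    ((interiorProduct (EuclideanSpace.single i 1 : Eu n) (v.toFun (P.proj e))).compLinearMap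
      (P.dproj e).toLinearMap))

theorem projectedForm_apply (γ : P.EhresmannConnection) (v : VolumeForm n N) (L : P.Jet → ℝ)
    (e : E) (Y : Fin n → P.TE e) :
    projectedForm γ v L e Y = ∑ p, v.toFun (P.proj e) (Function.update (fun q => P.dproj e (Y q)) p
      (momentum L (P.jetOver e) (γ.toVert e (Y p)))) := by
  refine (wedgeDual_interiorProduct_apply (F := Eu n) (γ.toVert e).toLinearMap
    (P.partialDeriv L (P.jetOver e)) (fun i => EuclideanSpace.single i 1) (v.toFun (P.proj e))
    (P.dproj e).toLinearMap Y).trans (Finset.sum_congr rfl fun p _ => ?_)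
  exact congrArg (fun u : Eu n => v.toFun (P.proj e) (Function.update
    (fun q => P.dproj e (Y q)) p u)) (momentum_eq_sum L (P.jetOver e) (γ.toVert e (Y p))).symm

/-- By (ii), `Λ = ((p¹₀)^*γ - θ) ∧ ω_Λ`, so `θ` cancels in `Θ_Λ` and `(p¹₀)^*γ ∧ ω_Λ` is left. By
`momentum_eq` its momenta may be taken at the chosen jet `P.jetOver j.pt`. -/
theorem poincareCartan_eq (γ : P.EhresmannConnection) (v : VolumeForm n N) {L : P.Jet → ℝ}
    (hL : ContMDiff 𝓘(ℝ, JetModel n m) 𝓘(ℝ, ℝ) ∞ L)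
    (h : ∀ j, L j = P.vertPairing L j (P.connectionDiffHom γ j)) (j : P.Jet) :
    P.poincareCartan v L j =
      (projectedForm γ v L j.pt).compLinearMap (P.dtoTotal j).toLinearMap := by
  have hH := covariantHamiltonian_eq γ v L j
  have h0 : (fun j => P.vertPairing L j (P.connectionDiffHom γ j) - L j) = 0 :=
    funext fun j => sub_eq_zero.2 (h j).symm
  rw [h0] at hH
  ext Z
  have hHZ : wedgeDual (P.connectionDiff γ j).toLinearMap (P.legendreForm v L j) Z -
      P.density v L j Z = 0 := by
    refine (DFunLike.congr_fun hH Z).trans ?_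
    exact zero_mul _
  rw [poincareCartan, AlternatingMap.add_apply, ← sub_eq_zero.1 hHZ,
    wedgeDual_legendreForm_apply, wedgeDual_legendreForm_apply, ← Finset.sum_add_distrib,
    AlternatingMap.compLinearMap_apply]
  refine Eq.trans ?_ (projectedForm_apply γ v L j.pt _).symm
  refine Finset.sum_congr rfl fun p _ => ?_
  refine ((v.toFun (P.toBase j)).map_update_add _ p _ _).symm.trans ?_
  have h1 : P.contactForm j (Z p) + P.connectionDiff γ j (Z p) =
      γ.toVert j.pt (P.dtoTotal j (Z p)) := by
    change P.contactForm j (Z p) + (γ.toVert j.pt (P.dtoTotal j (Z p)) - P.contactForm j (Z p)) = _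
    abel
  have h2 : momentum L j (P.contactForm j (Z p)) + momentum L j (P.connectionDiff γ j (Z p)) =
      momentum L (P.jetOver j.pt) (γ.toVert j.pt (P.dtoTotal j (Z p))) := by
    rw [← map_add, h1]
    exact (momentum_eq γ hL h j _ _ _).symm
  have h3 : (fun q => P.dtoBase j (Z q)) = fun q => P.dproj j.pt (P.dtoTotal j (Z q)) :=
    funext fun q => dtoBase_apply j (Z q)
  exact congrArg₂ (fun (X : Fin n → Eu n) (u : Eu n) =>
    v.toFun (P.proj j.pt) (Function.update X p u)) h3 h2

end FibredManifold

end

/-! ### Smoothness of the projected form. -/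

noncomputable section

theorem ContMDiffOn.tangentMap_of_isOpen {F F' M M' : Type*} [NormedAddCommGroup F]
    [NormedSpace ℝ F] [NormedAddCommGroup F'] [NormedSpace ℝ F'] [TopologicalSpace M]
    [ChartedSpace F M] [IsManifold 𝓘(ℝ, F) ∞ M] [TopologicalSpace M'] [ChartedSpace F' M']
    [IsManifold 𝓘(ℝ, F') ∞ M'] {f : M → M'} {s : Set M}
    (hf : ContMDiffOn 𝓘(ℝ, F) 𝓘(ℝ, F') ∞ f s) (hs : IsOpen s) :
    ContMDiffOn (𝓘(ℝ, F).prod 𝓘(ℝ, F)) (𝓘(ℝ, F').prod 𝓘(ℝ, F')) ∞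
      (tangentMap 𝓘(ℝ, F) 𝓘(ℝ, F') f) (Bundle.TotalSpace.proj ⁻¹' s) := by
  have : IsManifold 𝓘(ℝ, F) 1 M := IsManifold.of_le (n := ∞) (by simp)
  have : IsManifold 𝓘(ℝ, F') 1 M' := IsManifold.of_le (n := ∞) (by simp)
  refine (hf.contMDiffOn_tangentMapWithin (m := ∞) (by simp) hs.uniqueMDiffOn).congr fun p hp => ?_
  exact (tangentMapWithin_eq_tangentMap (hs.uniqueMDiffOn _ hp)
    ((hf.contMDiffAt (hs.mem_nhds hp)).mdifferentiableAt (by simp))).symm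

/-- In a smooth parametrization, applying a smooth field of endomorphisms to the coordinate vector
fields and taking the differential of a smooth map gives a smooth function. -/
theorem contDiffOn_mfderiv_endomorphism {d : ℕ} {F M : Type*} [NormedAddCommGroup F]
    [NormedSpace ℝ F] [TopologicalSpace M] [ChartedSpace (Eu d) M]
    [IsManifold 𝓘(ℝ, Eu d) ∞ M]
    {A : ∀ x : M, TangentSpace 𝓘(ℝ, Eu d) x →L[ℝ] TangentSpace 𝓘(ℝ, Eu d) x}
    (hA : ContMDiff 𝓘(ℝ, Eu d) (𝓘(ℝ, Eu d).prod 𝓘(ℝ, Eu d →L[ℝ] Eu d)) ∞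
      (fun x : M => Bundle.TotalSpace.mk' (Eu d →L[ℝ] Eu d)
        (E := fun x : M => TangentSpace 𝓘(ℝ, Eu d) x →L[ℝ] TangentSpace 𝓘(ℝ, Eu d) x) x (A x)))
    {σ : Eu d → M} {s : Set (Eu d)} (hs : IsOpen s)
    (hσ : ContMDiffOn 𝓘(ℝ, Eu d) 𝓘(ℝ, Eu d) ∞ σ s) {f : M → F} {t : Set M} (ht : IsOpen t)
    (hf : ContMDiffOn 𝓘(ℝ, Eu d) 𝓘(ℝ, F) ∞ f t) (hst : MapsTo σ s t) (w : Eu d) :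
    ContDiffOn ℝ ∞ (fun a => (mfderiv 𝓘(ℝ, Eu d) 𝓘(ℝ, F) f (σ a)
      (A (σ a) (mfderiv 𝓘(ℝ, Eu d) 𝓘(ℝ, Eu d) σ a w)) : F)) s := by
  have h1 : ContMDiffOn 𝓘(ℝ, Eu d) (𝓘(ℝ, Eu d).prod 𝓘(ℝ, Eu d)) ∞
      (fun a : Eu d => (⟨a, w⟩ : TangentBundle 𝓘(ℝ, Eu d) (Eu d))) s :=
    contMDiffOn_vectorSpace_iff_contDiffOn.2 contDiffOn_const
  have h2 : ContMDiffOn 𝓘(ℝ, Eu d) (𝓘(ℝ, Eu d).prod 𝓘(ℝ, Eu d)) ∞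
      (fun a : Eu d => (⟨σ a, mfderiv 𝓘(ℝ, Eu d) 𝓘(ℝ, Eu d) σ a w⟩ :
        TangentBundle 𝓘(ℝ, Eu d) M)) s :=
    (hσ.tangentMap_of_isOpen hs).comp h1 (fun a ha => ha)
  have h3 : ContMDiffOn 𝓘(ℝ, Eu d) (𝓘(ℝ, Eu d).prod 𝓘(ℝ, Eu d)) ∞
      (fun a : Eu d => (⟨σ a, A (σ a) (mfderiv 𝓘(ℝ, Eu d) 𝓘(ℝ, Eu d) σ a w)⟩ :
        TangentBundle 𝓘(ℝ, Eu d) M)) s :=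
    ContMDiffOn.clm_bundle_apply (hA.comp_contMDiffOn hσ) h2
  have h4 := (hf.tangentMap_of_isOpen ht).comp h3 (fun a ha => hst ha)
  exact contMDiffOn_iff_contDiffOn.1
    ((contMDiff_snd_tangentBundle_modelSpace F 𝓘(ℝ, F)).comp_contMDiffOn h4)

theorem AlternatingMap.map_linearMap_comp_eq_det {n : ℕ} {F G : Type*} [AddCommGroup F] [Module ℝ F]
    [AddCommGroup G] [Module ℝ G] (b : Module.Basis (Fin n) ℝ F) (v : G [⋀^Fin n]→ₗ[ℝ] ℝ)
    (A : F →ₗ[ℝ] G) (ξ : Fin n → F) :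
    v (fun i => A (ξ i)) = v (fun i => A (b i)) * b.det ξ :=
  DFunLike.congr_fun ((v.compLinearMap A).eq_smul_basis_det b) ξ

namespace FibredManifold

variable {n m : ℕ} {E N : Type*}
  [TopologicalSpace E] [ChartedSpace (Eu (m + n)) E]
  [TopologicalSpace N] [ChartedSpace (Eu n) N]
  [IsManifold 𝓘(ℝ, Eu (m + n)) ∞ E] [IsManifold 𝓘(ℝ, Eu n) ∞ N]
  {P : FibredManifold n m E N}

/-- The standard basis of `ℝⁿ`. -/
abbrev stdBasis (n : ℕ) : Module.Basis (Fin n) ℝ (Eu n) :=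
  (EuclideanSpace.basisFun (Fin n) ℝ).toBasis

namespace FibredChart

variable (c : P.FibredChart)

/-- The component of a volume form in the coordinates `xⁱ`. -/
def volumeComponent (v : VolumeForm n N) (b : Eu n) : ℝ :=
  v.toFun (c.base.symm b) (fun i => c.dbaseSymm b (stdBasis n i))

theorem volumeForm_apply_dbaseSymm (v : VolumeForm n N) {x : N} (hx : x ∈ c.base.source)
    (ξ : Fin n → Eu n) : v.toFun x (fun i => c.dbaseSymm (c.base x) (ξ i)) =
      c.volumeComponent v (c.base x) * (stdBasis n).det ξ := by
  rw [volumeComponent, c.base.left_inv hx]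
  exact AlternatingMap.map_linearMap_comp_eq_det (stdBasis n)
    (v.toFun x : Eu n [⋀^Fin n]→ₗ[ℝ] ℝ) (c.dbaseSymm (c.base x)).toLinearMap ξ

/-- `IsSmoothForm` speaks only of the charts `chartAt`. In the coordinates of `c.base` the component
is the one in such a chart, composed with the transition map and multiplied by its Jacobian
determinant. -/
theorem contDiffOn_volumeComponent (v : VolumeForm n N) :
    ContDiffOn ℝ ∞ (c.volumeComponent v) c.base.target := by
  intro b₀ hb₀
  set φ := chartAt (Eu n) (c.base.symm b₀)
  have hb₀' : b₀ ∈ (c.base.symm.trans φ).source := ⟨hb₀, mem_chart_source _ _⟩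
  have hopen := (c.base.symm.trans φ).open_source
  have hτ : ContDiffOn ℝ ∞ (φ ∘ c.base.symm) (c.base.symm.trans φ).source := by
    rw [← contMDiffOn_iff_contDiffOn]
    refine (contMDiffOn_chart (I := 𝓘(ℝ, Eu n)) (n := ∞)).comp
      (c.smooth_base_symm.mono fun b hb => hb.1) fun b hb => hb.2
  have hφ : φ.MDifferentiable 𝓘(ℝ, Eu n) 𝓘(ℝ, Eu n) := mdifferentiable_chart _
  have hdτ := hτ.fderiv_of_isOpen hopen (m := ∞) (by simp)
  have hg := (v.smooth (c.base.symm b₀) (stdBasis n)).comp hτ fun b hb => φ.map_source hb.2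
  have hdet : ContDiffOn ℝ ∞ (fun b => (stdBasis n).det
      (fun i => fderiv ℝ (φ ∘ c.base.symm) b (stdBasis n i))) (c.base.symm.trans φ).source :=
    contDiffOn_det _ fun i => hdτ.clm_apply contDiffOn_const
  refine (((hg.mul hdet).congr fun b hb => ?_).contDiffAt
    (hopen.mem_nhds hb₀')).contDiffWithinAt
  have h1 : HasMFDerivAt 𝓘(ℝ, Eu n) 𝓘(ℝ, Eu n) c.base.symm b (c.dbaseSymm b) :=
    (c.mdiff_base.symm.mdifferentiableAt hb.1).hasMFDerivAt
  obtain ⟨D, hD⟩ : ∃ D : Eu n →L[ℝ] Eu n,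
    D = mfderiv 𝓘(ℝ, Eu n) 𝓘(ℝ, Eu n) φ (c.base.symm b) := ⟨_, rfl⟩
  have h2 : HasMFDerivAt 𝓘(ℝ, Eu n) 𝓘(ℝ, Eu n) φ (c.base.symm b) D := by
    rw [hD]
    exact (hφ.mdifferentiableAt hb.2).hasMFDerivAt
  have h3 : HasFDerivAt (φ ∘ c.base.symm) (D.comp (c.dbaseSymm b)) b :=
    hasMFDerivAt_iff_hasFDerivAt.1 (h2.comp b h1)
  have h4 : ∀ y : Eu n, c.dbaseSymm b y = mfderiv 𝓘(ℝ, Eu n) 𝓘(ℝ, Eu n) φ.symm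
      (φ (c.base.symm b)) (fderiv ℝ (φ ∘ c.base.symm) b y) := fun y => by
    rw [h3.fderiv, hD]
    exact (DFunLike.congr_fun (hφ.symm_comp_deriv hb.2) (c.dbaseSymm b y)).symm
  have h5 := AlternatingMap.map_linearMap_comp_eq_det (stdBasis n)
    (v.toFun (c.base.symm b) : Eu n [⋀^Fin n]→ₗ[ℝ] ℝ)
    (mfderiv 𝓘(ℝ, Eu n) 𝓘(ℝ, Eu n) φ.symm (φ (c.base.symm b)) : Eu n →L[ℝ] Eu n).toLinearMap
    (fun i => fderiv ℝ (φ ∘ c.base.symm) b (stdBasis n i))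
  refine (congrArg (v.toFun (c.base.symm b)) (funext fun i => h4 _)).trans (h5.trans ?_)
  have h6 : φ.symm (φ (c.base.symm b)) = c.base.symm b := φ.left_inv hb.2
  -- Moves the form from `φ.symm (φ x)` to `x`, the tangent spaces at both points being the same
  -- model space.
  have h7 : ∀ x : N, x = c.base.symm b → ∀ X : Fin n → Eu n,
      v.toFun (c.base.symm b) X = v.toFun x X := by
    rintro _ rfl _
    rfl
  exact congrArg (· * _) (h7 _ h6 _)

theorem dproj_eq {e : E} (he : e ∈ c.total.source) (Y : P.TE e) :
    P.dproj e Y = c.dbaseSymm (c.base (P.proj e)) (c.dtotal e Y).1 := by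
  exact ((congrArg (c.dbaseSymm (c.base (P.proj e))) (c.fst_dtotal he Y)).trans
    (c.dbaseSymm_dbase (c.proj_mem e he) _)).symm

/-- The momenta `∂L/∂y^α_i` in coordinates, contracted with a vector `(w^α)`. -/
def coordMomentum (L : P.Jet → ℝ) (q : JetModel n m) (w : Eu m) : Eu n :=
  ∑ i, fderiv ℝ (L ∘ c.jetHomeo.symm) q
    (0, (EuclideanSpace.proj i : Eu n →L[ℝ] ℝ).smulRight w) • EuclideanSpace.single i (1 : ℝ)

/-- `partialDeriv` uses the standard basis of the model of `T_x N`, not the coordinate fields of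
`c`. The contraction `momentum` is independent of the basis, so the two expressions differ only by
`c.dbaseSymm`. -/
theorem momentum_eq_coordMomentum {L : P.Jet → ℝ}
    (hL : ContMDiff 𝓘(ℝ, JetModel n m) 𝓘(ℝ, ℝ) ∞ L) {j : P.Jet} (hj : j.pt ∈ c.total.source)
    (w : P.Vert j.pt) : momentum L j w = c.dbaseSymm (c.base (P.proj j.pt))
      (c.coordMomentum L (c.jetCoord j) (c.dtotal j.pt (w : P.TE j.pt)).2) := by
  have hx := c.proj_mem _ hj
  suffices h : c.dbase (P.proj j.pt) (momentum L j w) =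
      c.coordMomentum L (c.jetCoord j) (c.dtotal j.pt (w : P.TE j.pt)).2 by
    rw [← h]
    exact (c.dbaseSymm_dbase hx _).symm
  ext i
  -- The covector `dxⁱ` of the chart `c`.
  let β : Eu n →L[ℝ] ℝ := (EuclideanSpace.proj i).comp (c.dbase (P.proj j.pt))
  have h1 : c.dbase (P.proj j.pt) (momentum L j w) i =
      P.dLagrangian L j (P.vertLift j (β.smulRight (w : P.VertModel j.pt) : P.VertHom j.pt)) := by
    change β (momentum L j w) = _
    rw [← sum_partialDeriv, momentum_eq_sum, map_sum]
    refine Finset.sum_congr rfl fun k _ => ?_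
    rw [map_smul, smul_eq_mul, mul_comm]
    exact ((P.partialDeriv L j k).map_smul (β (EuclideanSpace.single k 1)) w).symm
  have h2 : c.vertJetCoord j.pt (β.smulRight (w : P.VertModel j.pt)) =
      (0, (EuclideanSpace.proj i : Eu n →L[ℝ] ℝ).smulRight (c.dtotal j.pt (w : P.TE j.pt)).2) := by
    refine Prod.ext rfl ?_
    ext1 x
    change (c.dtotal j.pt ((c.dbase (P.proj j.pt) (c.dbaseSymm (c.base (P.proj j.pt)) x)) i •
      (w : P.TE j.pt))).2 = x i • (c.dtotal j.pt (w : P.TE j.pt)).2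
    rw [c.dbase_dbaseSymm hx]
    exact congrArg Prod.snd ((c.dtotal j.pt).map_smul (x i) (w : P.TE j.pt))
  rw [h1, c.dLagrangian_vertLift hL hj, h2, coordMomentum]
  simp [Finset.sum_apply, Pi.single_apply]

theorem contDiffOn_coordMomentum {G : Type*} [NormedAddCommGroup G] [NormedSpace ℝ G] {L : P.Jet → ℝ}
    (hL : ContMDiff 𝓘(ℝ, JetModel n m) 𝓘(ℝ, ℝ) ∞ L) {s : Set G} {q : G → JetModel n m}
    {w : G → Eu m} (hq : ContDiffOn ℝ ∞ q s) (hw : ContDiffOn ℝ ∞ w s)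
    (hs : MapsTo q s c.jetHomeo.target) :
    ContDiffOn ℝ ∞ (fun a => c.coordMomentum L (q a) (w a)) s := by
  have h1 := ((c.contDiffOn_comp_jetHomeo_symm hL).fderiv_of_isOpen c.jetHomeo.open_target
    (m := ∞) (by simp)).comp hq hs
  refine ContDiffOn.sum fun i _ => ContDiffOn.smul (h1.clm_apply ?_) contDiffOn_const
  exact contDiffOn_const.prodMk ((ContinuousLinearMap.smulRightL ℝ (Eu n) (Eu m)
    (EuclideanSpace.proj i)).contDiff.comp_contDiffOn hw)

/-- `P.jetOver` is an arbitrary choice, with no smoothness in `e`. The jet with `y^α_i = 0` depends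
smoothly on `e` and, by `momentum_eq`, gives the same momenta. -/
theorem exists_lift_jetCoord_eq {e : E} (he : e ∈ c.total.source) :
    ∃ (l : P.TN e →L[ℝ] P.TE e) (hl : ∀ x, P.dproj e (l x) = x),
      c.jetCoord ⟨e, l, hl⟩ = (c.total e, 0) := by
  have h : ∀ j : P.Jet, j.pt = e → c.jetCoord j = (c.total e, 0) →
      ∃ (l : P.TN e →L[ℝ] P.TE e) (hl : ∀ x, P.dproj e (l x) = x),
        c.jetCoord ⟨e, l, hl⟩ = (c.total e, 0) := by
    rintro j rfl hj
    exact ⟨j.lift, j.dproj_lift, hj⟩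
  exact h (c.ofJetCoord (c.total e, 0) (c.total.map_source he)) (c.total.left_inv he)
    (c.jetCoord_ofJetCoord _ _)

theorem projectedForm_apply (γ : P.EhresmannConnection) (v : VolumeForm n N) {L : P.Jet → ℝ}
    (hL : ContMDiff 𝓘(ℝ, JetModel n m) 𝓘(ℝ, ℝ) ∞ L)
    (h : ∀ j, L j = P.vertPairing L j (P.connectionDiffHom γ j)) {e : E}
    (he : e ∈ c.total.source) (Y : Fin n → P.TE e) :
    projectedForm γ v L e Y = ∑ p, c.volumeComponent v (c.total e).1 *
      (stdBasis n).det (Function.update (fun q => (c.dtotal e (Y q)).1) p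
        (c.coordMomentum L (c.total e, 0) (c.dtotal e (γ.toFun e (Y p))).2)) := by
  rw [FibredManifold.projectedForm_apply]
  refine Finset.sum_congr rfl fun p _ => ?_
  obtain ⟨l, hl, hq⟩ := c.exists_lift_jetCoord_eq he
  have h1 : momentum L (P.jetOver e) (γ.toVert e (Y p)) = c.dbaseSymm (c.base (P.proj e))
      (c.coordMomentum L (c.total e, 0) (c.dtotal e (γ.toFun e (Y p))).2) := by
    refine (momentum_eq γ hL h ⟨e, l, hl⟩ _ (P.jetOver e).dproj_lift (γ.toVert e (Y p))).trans ?_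
    refine (c.momentum_eq_coordMomentum hL (j := ⟨e, l, hl⟩) he _).trans ?_
    rw [hq]
    rfl
  rw [c.fst_total e he, ← c.volumeForm_apply_dbaseSymm v (c.proj_mem e he)]
  refine congrArg (v.toFun (P.proj e)) (funext fun q => ?_)
  by_cases hpq : q = p
  · subst hpq
    refine (Function.update_self _ _ _).trans (h1.trans ?_)
    rw [Function.update_self]
  · refine (Function.update_of_ne hpq _ _).trans ((c.dproj_eq he (Y q)).trans ?_)
    rw [Function.update_of_ne hpq]

end FibredChart

/-- Smoothness is local, so near each point a fibred chart may be used; there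
`FibredChart.projectedForm_apply` expresses the form through the volume component, the momenta at
`y^α_i = 0`, the components of `γ` and determinants, all smooth. -/
theorem isSmoothForm_projectedForm (γ : P.EhresmannConnection) (v : VolumeForm n N) {L : P.Jet → ℝ}
    (hL : ContMDiff 𝓘(ℝ, JetModel n m) 𝓘(ℝ, ℝ) ∞ L)
    (h : ∀ j, L j = P.vertPairing L j (P.connectionDiffHom γ j)) :
    IsSmoothForm (projectedForm γ v L) := by
  intro x₀ w a₀ ha₀
  set φ := chartAt (Eu (m + n)) x₀
  obtain ⟨c, hc⟩ := P.exists_fibredChart (φ.symm a₀)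
  set U := (φ.symm.trans c.total).source
  have hU : IsOpen U := (φ.symm.trans c.total).open_source
  have hφ : φ.MDifferentiable 𝓘(ℝ, Eu (m + n)) 𝓘(ℝ, Eu (m + n)) := mdifferentiable_chart _
  have hσ : ContMDiffOn 𝓘(ℝ, Eu (m + n)) 𝓘(ℝ, Eu (m + n)) ∞ φ.symm U :=
    (contMDiffOn_chart_symm (I := 𝓘(ℝ, Eu (m + n))) (n := ∞)).mono fun a ha => ha.1
  have hUc : MapsTo φ.symm U c.total.source := fun a ha => ha.2
  have hτ : ContDiffOn ℝ ∞ (c.total ∘ φ.symm) U :=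
    contMDiffOn_iff_contDiffOn.1 (c.smooth_total.comp hσ hUc)
  have hdτ := hτ.fderiv_of_isOpen hU (m := ∞) (by simp)
  have hζ : ∀ i, ContDiffOn ℝ ∞ (fun a => c.dtotal (φ.symm a)
      (mfderiv 𝓘(ℝ, Eu (m + n)) 𝓘(ℝ, Eu (m + n)) φ.symm a (w i))) U := fun i => by
    refine (hdτ.clm_apply (contDiffOn_const (c := w i))).congr fun a ha => ?_
    obtain ⟨D, hD⟩ : ∃ D : Eu (m + n) →L[ℝ] Eu (m + n),
      D = mfderiv 𝓘(ℝ, Eu (m + n)) 𝓘(ℝ, Eu (m + n)) φ.symm a := ⟨_, rfl⟩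
    have h1 : HasMFDerivAt 𝓘(ℝ, Eu (m + n)) 𝓘(ℝ, Eu (m + n)) φ.symm a D := by
      rw [hD]
      exact (hφ.symm.mdifferentiableAt ha.1).hasMFDerivAt
    have h2 : HasMFDerivAt 𝓘(ℝ, Eu (m + n)) 𝓘(ℝ, Eu n × Eu m) c.total (φ.symm a)
      (c.dtotal (φ.symm a)) := (c.mdiff_total.mdifferentiableAt ha.2).hasMFDerivAt
    have h3 : HasFDerivAt (c.total ∘ φ.symm) ((c.dtotal (φ.symm a)).comp D) a :=
      hasMFDerivAt_iff_hasFDerivAt.1 (h2.comp a h1)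
    rw [h3.fderiv, hD]
    rfl
  have hκ : ∀ i, ContDiffOn ℝ ∞ (fun a => c.dtotal (φ.symm a) (γ.toFun (φ.symm a)
      (mfderiv 𝓘(ℝ, Eu (m + n)) 𝓘(ℝ, Eu (m + n)) φ.symm a (w i)))) U := fun i =>
    contDiffOn_mfderiv_endomorphism γ.smooth hU hσ c.total.open_source c.smooth_total hUc (w i)
  have hvol : ContDiffOn ℝ ∞ (fun a => c.volumeComponent v (c.total (φ.symm a)).1) U :=
    (c.contDiffOn_volumeComponent v).comp hτ.fst fun a ha => by
      rw [c.fst_total _ (hUc ha)]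
      exact c.base.map_source (c.proj_mem _ (hUc ha))
  have hq : ContDiffOn ℝ ∞ (fun a => ((c.total (φ.symm a), 0) : JetModel n m)) U :=
    hτ.prodMk contDiffOn_const
  have hμ := fun i => c.contDiffOn_coordMomentum hL hq (hκ i).snd
    fun a ha => c.total.map_source ha.2
  have hsum : ContDiffOn ℝ ∞ (fun a => ∑ p, c.volumeComponent v (c.total (φ.symm a)).1 *
      (stdBasis n).det (Function.update (fun q => (c.dtotal (φ.symm a)
        (mfderiv 𝓘(ℝ, Eu (m + n)) 𝓘(ℝ, Eu (m + n)) φ.symm a (w q))).1) p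
        (c.coordMomentum L (c.total (φ.symm a), 0) (c.dtotal (φ.symm a) (γ.toFun (φ.symm a)
          (mfderiv 𝓘(ℝ, Eu (m + n)) 𝓘(ℝ, Eu (m + n)) φ.symm a (w p)))).2))) U := by
    refine ContDiffOn.sum fun p _ => hvol.mul (contDiffOn_det _ fun q => ?_)
    by_cases hpq : q = p
    · subst hpq
      simp only [Function.update_self]
      exact hμ q
    · simp only [Function.update_of_ne hpq]
      exact (hζ q).fst
  refine ((hsum.congr fun a ha => ?_).contDiffAt
    (hU.mem_nhds ⟨ha₀, hc⟩)).contDiffWithinAt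
  exact c.projectedForm_apply γ v hL h ha.2 _

end FibredManifold
end

/-! ### The proposition. -/

theorem mainTheorem9 {n m : ℕ} {E N : Type*}
    [TopologicalSpace E] [ChartedSpace (Eu (m + n)) E] [IsManifold 𝓘(ℝ, Eu (m + n)) ∞ E]
    [TopologicalSpace N] [ChartedSpace (Eu n) N] [IsManifold 𝓘(ℝ, Eu n) ∞ N]
    (P : FibredManifold n m E N) (γ : P.EhresmannConnection) (v : VolumeForm n N)
    (L : P.Jet → ℝ) (hL : ContMDiff 𝓘(ℝ, JetModel n m) 𝓘(ℝ, ℝ) ∞ L) :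
    (∃! H : P.Jet → ℝ, ∀ j, P.covariantHamiltonian γ v L j = P.density v H j) ∧
    ∀ H : P.Jet → ℝ, (∀ j, P.covariantHamiltonian γ v L j = P.density v H j) →
      ((∀ j, H j = 0) ↔
        P.ProjectsOntoTotal (P.poincareCartan v L) ∧
        ∀ j, L j = P.vertPairing L j (P.connectionDiffHom γ j)) := by
  have hH : ∀ H : P.Jet → ℝ, (∀ j, P.covariantHamiltonian γ v L j = P.density v H j) →
      ∀ j, H j = P.vertPairing L j (P.connectionDiffHom γ j) - L j := fun H h j =>
    FibredManifold.density_injective v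
      ((h j).symm.trans (FibredManifold.covariantHamiltonian_eq γ v L j))
  refine ⟨⟨_, FibredManifold.covariantHamiltonian_eq γ v L, fun H h => funext (hH H h)⟩, ?_⟩
  intro H h
  -- The vanishing of `L^γ` is (ii) alone; (i) is then a consequence of (ii), with `projectedForm`
  -- as the form on `E`.
  have hiff : (∀ j, H j = 0) ↔ ∀ j, L j = P.vertPairing L j (P.connectionDiffHom γ j) :=
    forall_congr' fun j => by rw [hH H h j, sub_eq_zero, eq_comm]
  rw [hiff]
  refine ⟨fun h2 => ⟨⟨FibredManifold.projectedForm γ v L, ?_, ?_⟩, h2⟩, fun h2 => h2.2⟩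
  · exact FibredManifold.isSmoothForm_projectedForm γ v hL h2
  · exact FibredManifold.poincareCartan_eq γ v hL h2
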